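/- Let $n\le p$ be non-negative integers. Write $e_0,\dots,e_n$ for the standard basis of $\mathbb C^{n+1}$, and similarly for $\mathbb C^{p+1}$. Consider $M=S^{2n+1}\times S^{2p+1}=U(n+1)/U(n)\times U(p+1)/U(p)$ with base point $o=(e_0,e_0)$, where $U(n)$ and $U(p)$ are embedded as the stabilizers of $e_0$. With $E_{\nu\mu}$ the matrix units, $Z_{\nu\mu}=E_{\nu\mu}-E_{\mu\nu}$ and $T_{\nu\mu}=E_{\nu\mu}+E_{\mu\nu}$, put $$X^j=\tfrac12\,iT_{00},\qquad Y^j_{2\nu-1}=Z_{\nu0},\qquad Y^j_{2\nu}=iT_{\nu0},$$ in $\mathfrak u(n+1)$ for $j=1$ ($1\le\nu\le n$) and in $\mathfrak u(p+1)$ for $j=2$ ($1\le\nu\le p$). An element $\zeta$ of $\mathfrak u(n+1)\times\mathfrak u(p+1)$ is regarded as the tangent vector $\frac{d}{dt}\big|_{t=0}\exp(t\zeta)\cdot o$ of $M$ at $o$; then $X^1,Y^1_1,\dots,Y^1_{2n},X^2,Y^2_1,\dots,Y^2_{2p}$ is a basis of $T_oM$. For $a\in\mathbb R$ and $c>0$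 let $g(a,c)$ be the $U(n+1)\times U(p+1)$-invariant Riemannian metric on $M$ with $$g(X^1,X^1)=\tfrac1c,\quad g(X^2,X^2)=\tfrac{a^2+c^2}{c},\quad g(X^1,X^2)=-\tfrac ac,\quad g(Y^1_i,Y^1_i)=g(Y^2_k,Y^2_k)=1$$ at $o$, and all other scalar products of distinct basis vectors equal to $0$. Let $K$ be the sectional curvature of $g(0,c)$ with $c=\sqrt{n/p}$. Then the following inequalities hold for all $2$-planes tangent to $M$ at any point, and the extreme values are attained on the planes at $o$ indicated. 1. If $0<\frac np\le\frac19$, then $4-3\sqrt{\frac pn}\le K\le\sqrt{\frac pn}$. The minimal value is attained on $Y^1_{2l-1}\wedge Y^1_{2l}$ $(l=1,\dots,n)$ and the maximal value on $\sqrt c\,X^1\wedge Y^1_i$ $(i=1,\dots,2n)$. 2. If $\frac19<\frac np\le\frac9{16}$, then $4-3\sqrt{\frac pn}\le K\le4-3\sqrt{\frac np}$. The minimal value is attained on $Y^1_{2l-1}\wedge Y^1_{2l}$ $(l=1,\dots,n)$ and the maximal value on $Y^2_{2m-1}\wedge Y^2_{2m}$ $(m=1,\dots,p)$. 3. If $\frac9{16}<\frac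 np\le1$, then $0\le K\le4-3\sqrt{\frac np}$. The minimal value is attained on $X^1\wedge X^2$, on $Y^1_{2l-1}\wedge Y^2_{2m-1}$ and on $Y^1_{2l}\wedge Y^2_{2m}$ $(l=1,\dots,n,\ m=1,\dots,p)$, and the maximal value on $Y^2_{2m-1}\wedge Y^2_{2m}$ $(m=1,\dots,p)$. -/

import Mathlib

open scoped Manifold ContDiff Matrix

noncomputable section

namespace Hopf

/-! ### Curvature of a field of bilinear forms on a vector space -/

section Coordinates

variable {E : Type*} [NormedAddCommGroup E] [NormedSpace ℝ E]

/-- Christoffel symbols of the first kind of `G` at `y`, as a covector in the last argument: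
`w ↦ ½ (∂_u G(v, w) + ∂_v G(u, w) - ∂_w G(u, v))`. -/
def christoffelLower (G : E → E →L[ℝ] E →L[ℝ] ℝ) (y u v : E) : E →L[ℝ] ℝ :=
  (1 / 2 : ℝ) • (fderiv ℝ G y u v + fderiv ℝ G y v u - ((fderiv ℝ G y).flip u).flip v)

/-- Christoffel symbols of the second kind: `christoffel G y u v = (∇_u V)(y)` for the
Levi-Civita connection of `G` and the constant vector field `V = v`. The index is raised with the
inverse of `G y : E → E*`. -/
def christoffel (G : E → E →L[ℝ] E →L[ℝ] ℝ) (y u v : E) : E :=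
  (G y).inverse (christoffelLower G y u v)

/-- The curvature tensor `R(u, v) w = ∇_u ∇_v w - ∇_v ∇_u w` of the Levi-Civita connection of `G`
at `y` (where `u`, `v`, `w` are extended to constant, hence commuting, vector fields). -/
def curvature (G : E → E →L[ℝ] E →L[ℝ] ℝ) (y u v w : E) : E :=
  fderiv ℝ (fun z => christoffel G z v w) y u - fderiv ℝ (fun z => christoffel G z u w) y v
    + christoffel G y u (christoffel G y v w) - christoffel G y v (christoffel G y u w)

/-- The sectional curvature of the plane spanned by `u` and `v`:
`G(R(u, v) v, u) / (G(u, u) G(v, v) - G(u, v)²)`. -/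
def coordSectionalCurvature (G : E → E →L[ℝ] E →L[ℝ] ℝ) (y u v : E) : ℝ :=
  G y (curvature G y u v v) u / (G y u u * G y v v - G y u v ^ 2)

end Coordinates

/-! ### Sectional curvature of a metric on a manifold -/

section Manifold

variable {E : Type*} [NormedAddCommGroup E] [NormedSpace ℝ E] {H : Type*} [TopologicalSpace H]
  (I : ModelWithCorners ℝ E H) {M : Type*} [TopologicalSpace M] [ChartedSpace H M]

/-- Pullback of a bilinear form along a linear map. -/
def pullbackForm {V W : Type*} [AddCommGroup V] [Module ℝ V] [TopologicalSpace V]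
    [IsTopologicalAddGroup V] [ContinuousSMul ℝ V]
    [AddCommGroup W] [Module ℝ W] [TopologicalSpace W]
    [IsTopologicalAddGroup W] [ContinuousSMul ℝ W]
    (B : W →L[ℝ] W →L[ℝ] ℝ) (f : V →L[ℝ] W) : V →L[ℝ] V →L[ℝ] ℝ :=
  (ContinuousLinearMap.precomp ℝ f).comp (B.comp f)

@[simp] lemma pullbackForm_apply {V W : Type*} [AddCommGroup V] [Module ℝ V] [TopologicalSpace V]
    [IsTopologicalAddGroup V] [ContinuousSMul ℝ V]
    [AddCommGroup W] [Module ℝ W] [TopologicalSpace W]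
    [IsTopologicalAddGroup W] [ContinuousSMul ℝ W]
    (B : W →L[ℝ] W →L[ℝ] ℝ) (f : V →L[ℝ] W) (u v : V) :
    pullbackForm B f u v = B (f u) (f v) := rfl

/-- The components of the metric `g` in the chart at `x`: the pullback of `g` by the inverse of
the extended chart at `x`. -/
def chartMetric (g : ∀ x : M, TangentSpace I x →L[ℝ] TangentSpace I x →L[ℝ] ℝ) (x : M) (y : E) :
    E →L[ℝ] E →L[ℝ] ℝ :=
  pullbackForm (V := E) (g ((extChartAt I x).symm y))
    (mfderiv 𝓘(ℝ, E) I (extChartAt I x).symm y)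

/-- The sectional curvature of the metric `g` at `x` along the plane spanned by the tangent
vectors `u` and `v`, computed in the chart at `x`. -/
def sectionalCurvature (g : ∀ x : M, TangentSpace I x →L[ℝ] TangentSpace I x →L[ℝ] ℝ) (x : M)
    (u v : TangentSpace I x) : ℝ :=
  coordSectionalCurvature (chartMetric I g x) (extChartAt I x x)
    (mfderiv I 𝓘(ℝ, E) (extChartAt I x) x u) (mfderiv I 𝓘(ℝ, E) (extChartAt I x) x v)

/-- The bivector `u ∧ v` is nonzero and the sectional curvature of its plane is `κ`. -/
def CurvatureOfPlaneEq (g : ∀ x : M, TangentSpace I x →L[ℝ] TangentSpace I x →L[ℝ] ℝ) (x : M)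
    (u v : TangentSpace I x) (κ : ℝ) : Prop :=
  LinearIndependent ℝ ![u, v] ∧ sectionalCurvature I g x u v = κ

end Manifold

/-! ### The manifold `S²ⁿ⁺¹ × S²ᵖ⁺¹` -/

/-- The Hermitian space `ℂⁿ⁺¹`. -/
abbrev Cn (n : ℕ) := EuclideanSpace ℂ (Fin (n + 1))

/-- The unit sphere `S²ⁿ⁺¹` of `ℂⁿ⁺¹`. -/
abbrev Sph (n : ℕ) := Metric.sphere (0 : Cn n) 1

instance finrank_Cn (n : ℕ) : Fact (Module.finrank ℝ (Cn n) = (2 * n + 1) + 1) :=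
  ⟨by rw [finrank_real_of_complex, finrank_euclideanSpace_fin]; ring⟩

/-- The product `S²ⁿ⁺¹ × S²ᵖ⁺¹`. -/
abbrev SS (n p : ℕ) := Sph n × Sph p

/-- The model with corners of `S²ⁿ⁺¹ × S²ᵖ⁺¹`. -/
abbrev ISS (n p : ℕ) := (𝓡 (2 * n + 1)).prod (𝓡 (2 * p + 1))

/-- The inclusion of `S²ⁿ⁺¹ × S²ᵖ⁺¹` in `ℂⁿ⁺¹ × ℂᵖ⁺¹`. -/
def incl (n p : ℕ) (x : SS n p) : Cn n × Cn p := (x.1, x.2)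

/-! ### The group `U(n+1)`, its Lie algebra and its action -/

/-- The action of `U(n+1)` on the sphere `S²ⁿ⁺¹`. -/
def act {n : ℕ} (A : Matrix.unitaryGroup (Fin (n + 1)) ℂ) (z : Sph n) : Sph n :=
  ⟨WithLp.toLp 2 ((A : Matrix (Fin (n + 1)) (Fin (n + 1)) ℂ) *ᵥ (z : Cn n).ofLp), by
    rw [mem_sphere_zero_iff_norm]
    have h : ‖Matrix.toEuclideanCLM (𝕜 := ℂ) (A : Matrix (Fin (n + 1)) (Fin (n + 1)) ℂ) (z : Cn n)‖
        = ‖(z : Cn n)‖ := by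
      apply ContinuousLinearMap.norm_map_of_mem_unitary
      exact Unitary.map_mem _ A.2
    rw [norm_eq_of_mem_sphere z] at h
    exact h⟩

/-- The Lie algebra `𝔲(n+1)` of skew-Hermitian matrices. -/
abbrev LieU (n : ℕ) := skewAdjoint (Matrix (Fin (n + 1)) (Fin (n + 1)) ℂ)

/-- The exponential map `𝔲(n+1) → U(n+1)`. -/
def expU {n : ℕ} (ξ : LieU n) : Matrix.unitaryGroup (Fin (n + 1)) ℂ :=
  ⟨NormedSpace.exp (ξ : Matrix (Fin (n + 1)) (Fin (n + 1)) ℂ), by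
    have h := skewAdjoint.mem_iff.mp ξ.2
    rw [Matrix.star_eq_conjTranspose] at h
    rw [Matrix.mem_unitaryGroup_iff, Matrix.star_eq_conjTranspose, ← Matrix.exp_conjTranspose, h,
      ← Matrix.exp_add_of_commute _ _ (Commute.refl (ξ : Matrix (Fin (n + 1)) (Fin (n + 1)) ℂ)).neg_right,
      add_neg_cancel, NormedSpace.exp_zero]⟩

/-- The matrix `Z_{νμ} = E_{νμ} - E_{μν}`. -/
def Z {n : ℕ} (ν μ : Fin (n + 1)) : Matrix (Fin (n + 1)) (Fin (n + 1)) ℂ :=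
  Matrix.single ν μ 1 - Matrix.single μ ν 1

/-- The matrix `T_{νμ} = E_{νμ} + E_{μν}`. -/
def T {n : ℕ} (ν μ : Fin (n + 1)) : Matrix (Fin (n + 1)) (Fin (n + 1)) ℂ :=
  Matrix.single ν μ 1 + Matrix.single μ ν 1

lemma Z_mem {n : ℕ} (ν μ : Fin (n + 1)) :
    Z ν μ ∈ skewAdjoint (Matrix (Fin (n + 1)) (Fin (n + 1)) ℂ) := by
  simp [skewAdjoint.mem_iff, Z, Matrix.star_eq_conjTranspose, Matrix.conjTranspose_single]

lemma iT_mem {n : ℕ} (ν μ : Fin (n + 1)) :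
    Complex.I • T ν μ ∈ skewAdjoint (Matrix (Fin (n + 1)) (Fin (n + 1)) ℂ) := by
  simp [skewAdjoint.mem_iff, T, Matrix.star_eq_conjTranspose, Matrix.conjTranspose_single,
    Matrix.single_neg, add_comm]

/-- `X = ½ i T₀₀`. -/
def X (n : ℕ) : LieU n := (1 / 2 : ℝ) • ⟨Complex.I • T 0 0, iT_mem 0 0⟩

/-- `Yodd ν` is the vector `Y_{2ν-1} = Z_{ν0}`, for `ν = 1, …, n` (here `ν - 1 : Fin n`). -/
def Yodd {n : ℕ} (ν : Fin n) : LieU n := ⟨Z ν.succ 0, Z_mem _ _⟩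

/-- `Yeven ν` is the vector `Y_{2ν} = i T_{ν0}`, for `ν = 1, …, n` (here `ν - 1 : Fin n`). -/
def Yeven {n : ℕ} (ν : Fin n) : LieU n := ⟨Complex.I • T ν.succ 0, iT_mem _ _⟩

/-- The base point `e₀` of `S²ⁿ⁺¹`, with stabilizer `U(n)`. -/
def e0 (n : ℕ) : Sph n := ⟨EuclideanSpace.single 0 1, by simp⟩

/-- The base point of `S²ⁿ⁺¹ × S²ᵖ⁺¹ = U(n+1)/U(n) × U(p+1)/U(p)`. -/
def basePt (n p : ℕ) : SS n p := (e0 n, e0 p)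

/-- The tangent vector at the base point defined by `(ξ, η) ∈ 𝔲(n+1) × 𝔲(p+1)`: the velocity at
`t = 0` of the curve `t ↦ (exp tξ, exp tη) · (e₀, e₀)`. -/
def tangentVec {n p : ℕ} (ζ : LieU n × LieU p) : TangentSpace (ISS n p) (basePt n p) :=
  mfderiv 𝓘(ℝ, ℝ) (ISS n p)
    (fun t : ℝ => ((act (expU (t • ζ.1)) (e0 n), act (expU (t • ζ.2)) (e0 p)) : SS n p)) 0 (1 : ℝ)

/-! ### The invariant metrics `g(a, c)` -/

/-- The real linear form `u ↦ Re ⟨i z, u⟩` on `ℂⁿ⁺¹`. On the tangent space of the sphere at `z` it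
is the component of `u` along the vertical unit vector `i z` of the Hopf fibration; at `e₀` this
vector is the one defined by `X`. -/
def hopfForm {n : ℕ} (z : Cn n) : Cn n →L[ℝ] ℝ := innerSL ℝ (Complex.I • z)

/-- The horizontal part `⟨u, v⟩ - η(u) η(v)` of the round metric, `η = hopfForm z`. -/
def horForm {n : ℕ} (z : Cn n) : Cn n →L[ℝ] Cn n →L[ℝ] ℝ :=
  let euclid : Cn n →L[ℝ] Cn n →L[ℝ] ℝ := innerSL ℝ
  euclid - (hopfForm z).smulRight (hopfForm z)

/-- The metric `g(a, c)` at `(z, w)`, written on the ambient vectors `u = (u₁, u₂)`,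
`v = (v₁, v₂)`: the round metric on horizontal vectors, and
`(1/c) η₁η₁ - (a/c) (η₁η₂ + η₂η₁) + ((a² + c²)/c) η₂η₂` on vertical vectors. -/
def ambientMetric {n p : ℕ} (a c : ℝ) (x : Cn n × Cn p) :
    (Cn n × Cn p) →L[ℝ] (Cn n × Cn p) →L[ℝ] ℝ :=
  let η₁ := (hopfForm x.1).comp (ContinuousLinearMap.fst ℝ (Cn n) (Cn p))
  let η₂ := (hopfForm x.2).comp (ContinuousLinearMap.snd ℝ (Cn n) (Cn p))
  pullbackForm (horForm x.1) (ContinuousLinearMap.fst ℝ (Cn n) (Cn p))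
    + pullbackForm (horForm x.2) (ContinuousLinearMap.snd ℝ (Cn n) (Cn p))
    + (1 / c) • η₁.smulRight η₁ - (a / c) • (η₁.smulRight η₂ + η₂.smulRight η₁)
    + ((a ^ 2 + c ^ 2) / c) • η₂.smulRight η₂

lemma ambientMetric_apply {n p : ℕ} (a c : ℝ) (x u v : Cn n × Cn p) :
    ambientMetric a c x u v =
      (inner ℝ u.1 v.1 - hopfForm x.1 u.1 * hopfForm x.1 v.1)
      + (inner ℝ u.2 v.2 - hopfForm x.2 u.2 * hopfForm x.2 v.2)
      + 1 / c * (hopfForm x.1 u.1 * hopfForm x.1 v.1)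
      - a / c * (hopfForm x.1 u.1 * hopfForm x.2 v.2 + hopfForm x.2 u.2 * hopfForm x.1 v.1)
      + (a ^ 2 + c ^ 2) / c * (hopfForm x.2 u.2 * hopfForm x.2 v.2) := rfl

/-- The metric `g(a, c)` on `S²ⁿ⁺¹ × S²ᵖ⁺¹`. -/
def metric (n p : ℕ) (a c : ℝ) (x : SS n p) :
    TangentSpace (ISS n p) x →L[ℝ] TangentSpace (ISS n p) x →L[ℝ] ℝ :=
  pullbackForm (V := TangentSpace (ISS n p) x) (W := Cn n × Cn p) (ambientMetric a c (incl n p x))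
    (mfderiv (ISS n p) 𝓘(ℝ, Cn n × Cn p) (incl n p) x)

end Hopf

end

noncomputable section
set_option maxSynthPendingDepth 3
namespace Hopf

/-! ### Curvature from the two-jet of a metric in a chart. -/

section GeneralCurvature

variable {E : Type*} [NormedAddCommGroup E] [NormedSpace ℝ E]

/-! For `a = 0` the mixed vertical term of the metric disappears, and `g(0, c)` is a Riemannian
product of two Berger spheres: the round metrics with the squared length of the Hopf direction
rescaled by `ε = 1/c` and `ε' = c`.

For one Berger sphere, let `P` be the squared area spanned by the horizontal parts `u_h`, `v_h` of
`u`, `v`; let `a`, `b` be their vertical components, `s = ⟪J u, v⟫` and `Q = |b u_h - a v_h|²`. Then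
the curvature numerator is `P - 3(ε - 1)s² + ε²Q` and the squared area of the plane is `P + εQ`.
Since `0 ≤ s² ≤ P`, the curvature lies between the minimum and the maximum of `1`, `ε`, `4 - 3ε`. In
the product the numerators add, while the squared area is at least the sum of those of the two
factors; so any lower bound `k ≤ 0` and upper bound `m ≥ 1` valid for both factors survive. It
remains to compare `0`, `1/c`, `4 - 3/c` and `4 - 3c`, which gives the thresholds `c = 1/3` and `c =
3/4`, and to evaluate the curvature on the listed planes.

The numerator is obtained in stereographic coordinates centred at the point, where the two-jet of
the metric is explicit (`form_curvature`, `jet_eq_bergerNum`). `chartMetric_eq` identifies the chart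
metric with this model, `sectionalCurvature_bounds` gives the inequalities, and
`curvatureOfPlaneEq_of_orbitVec` gives the attained values. -/

lemma fderiv_form_apply {G : E → E →L[ℝ] E →L[ℝ] ℝ} {z : E} (hG : DifferentiableAt ℝ G z)
    (h u v : E) : fderiv ℝ G z h u v = fderiv ℝ (fun y => G y u v) z h := by
  have h1 := (hG.hasFDerivAt.clm_apply (hasFDerivAt_const u z)).clm_apply (hasFDerivAt_const v z)
  rw [h1.fderiv]
  simp

lemma fderiv_form_symm {G : E → E →L[ℝ] E →L[ℝ] ℝ} {z : E} (hG : DifferentiableAt ℝ G z)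
    (hsymm : ∀ y u v, G y u v = G y v u) (h u v : E) :
    fderiv ℝ G z h u v = fderiv ℝ G z h v u := by
  rw [fderiv_form_apply hG, fderiv_form_apply hG]
  simp_rw [hsymm _ u v]

/-- The iterated derivative `∂_k ∂_h G(u, v)` at `y`. -/
def secondDeriv (G : E → E →L[ℝ] E →L[ℝ] ℝ) (y k h u v : E) : ℝ :=
  fderiv ℝ (fun z => fderiv ℝ G z h u v) y k

lemma christoffelLower_apply (G : E → E →L[ℝ] E →L[ℝ] ℝ) (y u v w : E) :
    christoffelLower G y u v w =
      1 / 2 * (fderiv ℝ G y u v w + fderiv ℝ G y v u w - fderiv ℝ G y w u v) := rfl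

lemma differentiableAt_christoffelLower {G : E → E →L[ℝ] E →L[ℝ] ℝ} {y : E}
    (hG : ContDiff ℝ 2 G) (u v : E) :
    DifferentiableAt ℝ (fun z => christoffelLower G z u v) y := by
  have hd : Differentiable ℝ (fderiv ℝ G) :=
    (hG.fderiv_right (m := 1) (by norm_num)).differentiable (by norm_num)
  have hf : Differentiable ℝ (fun z => (fderiv ℝ G z).flip) :=
    (ContinuousLinearMap.flipₗᵢ ℝ E E (E →L[ℝ] ℝ)).toContinuousLinearEquiv.differentiable.comp hd
  have hf' : Differentiable ℝ (fun z => ((fderiv ℝ G z).flip u).flip) :=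
    (ContinuousLinearMap.flipₗᵢ ℝ E E ℝ).toContinuousLinearEquiv.differentiable.comp
      (hf.clm_apply (differentiable_const u))
  unfold christoffelLower
  fun_prop

lemma fderiv_christoffelLower_apply {G : E → E →L[ℝ] E →L[ℝ] ℝ} {y : E}
    (hG : ContDiff ℝ 2 G) (u v w k : E) :
    fderiv ℝ (fun z => christoffelLower G z u v) y k w =
      1 / 2 * (secondDeriv G y k u v w + secondDeriv G y k v u w - secondDeriv G y k w u v) := by
  have hd : Differentiable ℝ (fderiv ℝ G) :=
    (hG.fderiv_right (m := 1) (by norm_num)).differentiable (by norm_num)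
  have hs : ∀ h a b : E, DifferentiableAt ℝ (fun z => fderiv ℝ G z h a b) y := by
    intro h a b
    fun_prop
  have h1 : fderiv ℝ (fun z => christoffelLower G z u v) y k w =
      fderiv ℝ (fun z => christoffelLower G z u v w) y k := by
    have h2 := ((ContinuousLinearMap.apply ℝ ℝ w).hasFDerivAt).comp y
      (differentiableAt_christoffelLower (y := y) hG u v).hasFDerivAt
    have h3 : HasFDerivAt (fun z => christoffelLower G z u v w) _ y := h2
    rw [h3.fderiv]
    rfl
  rw [h1]
  simp_rw [christoffelLower_apply]
  rw [fderiv_const_mul ((((hs _ _ _).fun_add (hs _ _ _)).fun_sub (hs _ _ _))),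
    fderiv_fun_sub ((hs _ _ _).fun_add (hs _ _ _)) (hs _ _ _),
    fderiv_fun_add (hs _ _ _) (hs _ _ _)]
  rfl

lemma form_christoffel {G : E → E →L[ℝ] E →L[ℝ] ℝ} {y : E} (hinv : (G y).IsInvertible)
    (u v : E) : G y (christoffel G y u v) = christoffelLower G y u v :=
  hinv.self_apply_inverse _

/-- Allows an index to be raised by guessing the answer, without computing the inverse of the
metric. -/
lemma christoffel_eq {G : E → E →L[ℝ] E →L[ℝ] ℝ} {y : E} (hinv : (G y).IsInvertible)
    {u v a : E} (h : ∀ w, christoffelLower G y u v w = G y a w) : christoffel G y u v = a := by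
  have : christoffelLower G y u v = G y a := by ext w; exact h w
  rw [christoffel, this, hinv.inverse_apply_self]

variable [CompleteSpace E]

lemma differentiableAt_christoffel {G : E → E →L[ℝ] E →L[ℝ] ℝ} {y : E}
    (hG : ContDiff ℝ 2 G) (hinv : (G y).IsInvertible) (u v : E) :
    DifferentiableAt ℝ (fun z => christoffel G z u v) y := by
  have h1 : DifferentiableAt ℝ (fun z => (G z).inverse) y :=
    ((hinv.contDiffAt_map_inverse (n := 1)).differentiableAt (by norm_num)).comp y
      (hG.differentiable (by norm_num) y)
  exact h1.clm_apply (differentiableAt_christoffelLower hG u v)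

lemma form_fderiv_christoffel {G : E → E →L[ℝ] E →L[ℝ] ℝ} {y : E}
    (hG : ContDiff ℝ 2 G) (hinv : (G y).IsInvertible) (u v k w : E) :
    G y (fderiv ℝ (fun z => christoffel G z u v) y k) w =
      fderiv ℝ (fun z => christoffelLower G z u v) y k w
        - fderiv ℝ G y k (christoffel G y u v) w := by
  -- Invertibility is an open condition, so `G Γ` equals the lowered symbol near `y` and the Leibniz
  -- rule can be applied to this identity.
  have hev : (fun z => G z (christoffel G z u v)) =ᶠ[nhds y]
      fun z => christoffelLower G z u v := by
    obtain ⟨e, he⟩ := hinv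
    have h1 : ∀ᶠ z in nhds y, G z ∈ Set.range
        (ContinuousLinearEquiv.toContinuousLinearMap : (E ≃L[ℝ] (E →L[ℝ] ℝ)) → E →L[ℝ] E →L[ℝ] ℝ) :=
      hG.continuous.continuousAt.eventually (by rw [← he]; exact ContinuousLinearEquiv.nhds e)
    filter_upwards [h1] with z hz
    exact form_christoffel (E := E) hz u v
  have h2 := (hG.differentiable (by norm_num) y).hasFDerivAt.clm_apply
    (differentiableAt_christoffel hG hinv u v).hasFDerivAt
  have h3 := hev.fderiv_eq (𝕜 := ℝ)
  rw [h2.fderiv] at h3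
  rw [← h3]
  simp

/-- The curvature in terms of the two-jet of the metric. -/
theorem form_curvature {G : E → E →L[ℝ] E →L[ℝ] ℝ} {y : E}
    (hG : ContDiff ℝ 2 G) (hsymm : ∀ y u v, G y u v = G y v u) (hinv : (G y).IsInvertible)
    (u v : E) :
    G y (curvature G y u v v) u =
      secondDeriv G y u v v u - 1 / 2 * secondDeriv G y u u v v - 1 / 2 * secondDeriv G y v v u u
        + christoffelLower G y u v (christoffel G y u v)
        - christoffelLower G y u u (christoffel G y v v) := by
  have hd := hG.differentiable (by norm_num) y
  have hs := fderiv_form_symm hd hsymm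
  have hss : ∀ k h a b, secondDeriv G y k h a b = secondDeriv G y k h b a := by
    intro k h a b
    unfold secondDeriv
    simp_rw [fderiv_form_symm (hG.differentiable (by norm_num) _) hsymm h a b]
  rw [curvature]
  simp only [map_sub, map_add, sub_apply, add_apply]
  rw [form_fderiv_christoffel hG hinv, form_fderiv_christoffel hG hinv,
    form_christoffel hinv, form_christoffel hinv,
    fderiv_christoffelLower_apply hG, fderiv_christoffelLower_apply hG]
  simp only [christoffelLower_apply]
  -- Only the symmetry of the form in its two arguments is used: the second derivatives `∂_v ∂_u`
  -- cancel in a pair, so derivatives never have to be commuted.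
  rw [hs u (christoffel G y v v) u, hs v (christoffel G y u v) u, hs (christoffel G y u v) v u,
    hss v u v u]
  ring

end GeneralCurvature


/-! ### The Berger metric in stereographic coordinates and its two-jet at the origin. -/

section BergerForm

open scoped RealInnerProductSpace

variable {V : Type*} [NormedAddCommGroup V]

/-- The conformal factor of the inverse stereographic projection. -/
def conf (y : V) : ℝ := 4 / (4 + ‖y‖ ^ 2)

lemma conf_zero : conf (0 : V) = 1 := by simp [conf]

variable [InnerProductSpace ℝ V]

lemma contDiff_conf : ContDiff ℝ ω (conf : V → ℝ) := by
  unfold conf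
  refine contDiff_const.div (contDiff_const.add (contDiff_norm_sq ℝ)) fun y => ?_
  positivity

/-- Derivatives are taken along lines, where the one-variable product rule suffices; smoothness then
identifies them with Fréchet derivatives. The gradient vanishes at the origin, which removes most
terms of the two-jet. -/
lemma hasLineDerivAt_conf (z h : V) :
    HasLineDerivAt ℝ (conf : V → ℝ) (-(conf z ^ 2 / 2 * ⟪z, h⟫)) z h := by
  have h1 : HasDerivAt (fun t : ℝ => 4 + ‖z + t • h‖ ^ 2) (2 * ⟪z, h⟫) 0 := by
    have := ((((hasDerivAt_id (0 : ℝ)).smul_const h).const_add z).norm_sq).const_add 4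
    simpa using this
  have h2 := (hasDerivAt_const (0 : ℝ) (4 : ℝ)).fun_div h1 (by positivity)
  unfold HasLineDerivAt conf
  refine h2.congr_deriv ?_
  simp only [zero_smul, add_zero]
  field_simp
  ring

/-- The pullback of the connection form of the Hopf fibration by the inverse stereographic
projection. Here `J` is the horizontal complex structure and `e` the vertical unit vector. -/
def connForm (J : V →L[ℝ] V) (e y : V) : V →L[ℝ] ℝ :=
  (conf y ^ 2) • innerSL ℝ (J y) + (conf y ^ 2 * ⟪e, y⟫ / 2) • innerSL ℝ y
    + (2 * conf y ^ 2 - conf y) • innerSL ℝ e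

lemma connForm_apply (J : V →L[ℝ] V) (e y u : V) :
    connForm J e y u = conf y ^ 2 * ⟪J y, u⟫ + conf y ^ 2 * ⟪e, y⟫ / 2 * ⟪y, u⟫
      + (2 * conf y ^ 2 - conf y) * ⟪e, u⟫ := by
  simp [connForm]

/-- The Berger metric with vertical scale `ε` in stereographic coordinates. -/
def bergerForm (J : V →L[ℝ] V) (e : V) (ε : ℝ) (y : V) : V →L[ℝ] V →L[ℝ] ℝ :=
  let euclid : V →L[ℝ] V →L[ℝ] ℝ := innerSL ℝ
  (conf y ^ 2) • euclid + (ε - 1) • (connForm J e y).smulRight (connForm J e y)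

lemma bergerForm_apply (J : V →L[ℝ] V) (e : V) (ε : ℝ) (y u v : V) :
    bergerForm J e ε y u v =
      conf y ^ 2 * ⟪u, v⟫ + (ε - 1) * (connForm J e y u * connForm J e y v) := rfl

lemma bergerForm_symm (J : V →L[ℝ] V) (e : V) (ε : ℝ) (y u v : V) :
    bergerForm J e ε y u v = bergerForm J e ε y v u := by
  rw [bergerForm_apply, bergerForm_apply, real_inner_comm, mul_comm (connForm J e y u)]

lemma bergerForm_zero_apply (J : V →L[ℝ] V) (e : V) (ε : ℝ) (u v : V) :
    bergerForm J e ε 0 u v = ⟪u, v⟫ + (ε - 1) * (⟪e, u⟫ * ⟪e, v⟫) := by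
  simp [bergerForm_apply, connForm_apply, conf_zero]
  left; ring

lemma contDiff_connForm (J : V →L[ℝ] V) (e : V) : ContDiff ℝ ω (connForm J e) := by
  have := contDiff_conf (V := V)
  have hI : ContDiff ℝ ω (fun y : V => (innerSL ℝ y : V →L[ℝ] ℝ)) :=
    (innerSL ℝ : V →L[ℝ] V →L[ℝ] ℝ).contDiff
  have hJ : ContDiff ℝ ω (fun y : V => (innerSL ℝ (J y) : V →L[ℝ] ℝ)) := hI.comp J.contDiff
  have he : ContDiff ℝ ω (fun y : V => ⟪e, y⟫) := contDiff_const.inner ℝ contDiff_id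
  unfold connForm
  exact (((this.pow 2).fun_smul hJ).add (((((this.pow 2).mul he).div_const 2).fun_smul hI))).add
    (((contDiff_const.mul (this.pow 2)).sub this).fun_smul contDiff_const)

lemma contDiff_bergerForm (J : V →L[ℝ] V) (e : V) (ε : ℝ) :
    ContDiff ℝ ω (bergerForm J e ε) := by
  have h1 := contDiff_conf (V := V)
  have h2 := contDiff_connForm J e
  have h3 := h2.smulRight h2
  unfold bergerForm
  exact ((h1.pow 2).fun_smul contDiff_const).add (contDiff_const.fun_smul h3)

/-- The derivative of `connForm J e z u` in the direction `h`. -/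
def dConnForm (J : V →L[ℝ] V) (e z h u : V) : ℝ :=
  -(conf z ^ 3 * ⟪z, h⟫ * ⟪J z, u⟫) + conf z ^ 2 * ⟪J h, u⟫
    - conf z ^ 3 * ⟪z, h⟫ * ⟪e, z⟫ * ⟪z, u⟫ / 2
    + conf z ^ 2 * ⟪e, h⟫ * ⟪z, u⟫ / 2 + conf z ^ 2 * ⟪e, z⟫ * ⟪h, u⟫ / 2
    - (4 * conf z - 1) * (conf z ^ 2 / 2 * ⟪z, h⟫) * ⟪e, u⟫

lemma hasDerivAt_inner_line (a z h : V) :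
    HasDerivAt (fun t : ℝ => ⟪z + t • h, a⟫) ⟪h, a⟫ 0 := by
  have := ((((hasDerivAt_id (0 : ℝ)).smul_const h).const_add z)).inner ℝ (hasDerivAt_const 0 a)
  simpa using this

lemma hasDerivAt_line_inner (a z h : V) :
    HasDerivAt (fun t : ℝ => ⟪a, z + t • h⟫) ⟪a, h⟫ 0 := by
  simp_rw [real_inner_comm _ a]
  exact hasDerivAt_inner_line a z h

lemma hasDerivAt_map_inner_line (J : V →L[ℝ] V) (a z h : V) :
    HasDerivAt (fun t : ℝ => ⟪J (z + t • h), a⟫) ⟪J h, a⟫ 0 := by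
  simp_rw [map_add, map_smul]
  exact hasDerivAt_inner_line a (J z) (J h)

lemma hasLineDerivAt_connForm (J : V →L[ℝ] V) (e z h u : V) :
    HasLineDerivAt ℝ (fun y => connForm J e y u) (dConnForm J e z h u) z h := by
  have hc : HasDerivAt (fun t : ℝ => conf (z + t • h)) _ 0 := hasLineDerivAt_conf z h
  have h1 := ((hc.fun_pow 2).fun_mul (hasDerivAt_map_inner_line J u z h)).fun_add
    (((((hc.fun_pow 2).fun_mul (hasDerivAt_line_inner e z h)).div_const 2).fun_mul
      (hasDerivAt_inner_line u z h))) |>.fun_add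
    ((((hc.fun_pow 2).const_mul 2).fun_sub hc).mul_const ⟪e, u⟫)
  unfold HasLineDerivAt
  simp_rw [connForm_apply]
  refine h1.congr_deriv ?_
  simp only [zero_smul, add_zero, dConnForm]
  ring

/-- At the origin `conf` is critical with value `1`, so only the terms of `dConnForm` with exactly
one factor linear in `z` contribute. The coefficient `3 / 2` is `(4 * conf - 1) / 2` there. -/
lemma hasLineDerivAt_dConnForm (J : V →L[ℝ] V) (e k h u : V) :
    HasLineDerivAt ℝ (fun z => dConnForm J e z h u)
      (1 / 2 * (⟪e, h⟫ * ⟪k, u⟫ + ⟪e, k⟫ * ⟪h, u⟫) - 3 / 2 * ⟪k, h⟫ * ⟪e, u⟫) 0 k := by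
  have hc : HasDerivAt (fun t : ℝ => conf (0 + t • k)) _ 0 := hasLineDerivAt_conf 0 k
  have hJ := hasDerivAt_map_inner_line J u 0 k
  have he := hasDerivAt_line_inner e 0 k
  have hu := hasDerivAt_inner_line u 0 k
  have hh := hasDerivAt_inner_line h 0 k
  have h1 := ((((hc.fun_pow 3).fun_mul hh).fun_mul hJ).fun_neg.fun_add
      ((hc.fun_pow 2).mul_const ⟪J h, u⟫)).fun_sub
      (((((hc.fun_pow 3).fun_mul hh).fun_mul he).fun_mul hu).div_const 2) |>.fun_add
      ((((hc.fun_pow 2).mul_const ⟪e, h⟫).fun_mul hu).div_const 2) |>.fun_add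
      ((((hc.fun_pow 2).fun_mul he).mul_const ⟪h, u⟫).div_const 2) |>.fun_sub
      ((((hc.const_mul 4).sub_const 1).fun_mul
        (((hc.fun_pow 2).div_const 2).fun_mul hh)).mul_const ⟪e, u⟫)
  unfold HasLineDerivAt dConnForm
  refine h1.congr_deriv ?_
  simp [conf_zero]
  ring

lemma fderiv_bergerForm_apply (J : V →L[ℝ] V) (e : V) (ε : ℝ) (z h u v : V) :
    fderiv ℝ (bergerForm J e ε) z h u v =
      -(conf z ^ 3 * ⟪z, h⟫) * ⟪u, v⟫ + (ε - 1) *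
        (dConnForm J e z h u * connForm J e z v + connForm J e z u * dConnForm J e z h v) := by
  have hd : DifferentiableAt ℝ (bergerForm J e ε) z :=
    (contDiff_bergerForm J e ε).differentiable (by simp) z
  rw [fderiv_form_apply hd]
  have hd' : DifferentiableAt ℝ (fun y => bergerForm J e ε y u v) z := by fun_prop
  rw [← hd'.lineDeriv_eq_fderiv]
  apply HasLineDerivAt.lineDeriv
  have hc : HasDerivAt (fun t : ℝ => conf (z + t • h)) _ 0 := hasLineDerivAt_conf z h
  have hu : HasDerivAt (fun t : ℝ => connForm J e (z + t • h) u) _ 0 :=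
    hasLineDerivAt_connForm J e z h u
  have hv : HasDerivAt (fun t : ℝ => connForm J e (z + t • h) v) _ 0 :=
    hasLineDerivAt_connForm J e z h v
  have h1 := ((hc.fun_pow 2).mul_const ⟪u, v⟫).fun_add ((hu.fun_mul hv).const_mul (ε - 1))
  unfold HasLineDerivAt
  simp_rw [bergerForm_apply]
  refine h1.congr_deriv ?_
  simp only [zero_smul, add_zero]
  ring

lemma connForm_zero (J : V →L[ℝ] V) (e u : V) : connForm J e 0 u = ⟪e, u⟫ := by
  simp [connForm_apply, conf_zero]
  ring

lemma dConnForm_zero (J : V →L[ℝ] V) (e h u : V) : dConnForm J e 0 h u = ⟪J h, u⟫ := by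
  simp [dConnForm, conf_zero]

lemma fderiv_bergerForm_zero (J : V →L[ℝ] V) (e : V) (ε : ℝ) (h u v : V) :
    fderiv ℝ (bergerForm J e ε) 0 h u v =
      (ε - 1) * (⟪J h, u⟫ * ⟪e, v⟫ + ⟪e, u⟫ * ⟪J h, v⟫) := by
  simp [fderiv_bergerForm_apply, connForm_zero, dConnForm_zero]

lemma secondDeriv_bergerForm_zero (J : V →L[ℝ] V) (e : V) (ε : ℝ) (k h u v : V) :
    secondDeriv (bergerForm J e ε) 0 k h u v =
      -(⟪k, h⟫ * ⟪u, v⟫) + (ε - 1) *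
        (⟪J h, u⟫ * ⟪J k, v⟫ + ⟪J k, u⟫ * ⟪J h, v⟫
        + (1 / 2 * (⟪e, h⟫ * ⟪k, u⟫ + ⟪e, k⟫ * ⟪h, u⟫) - 3 / 2 * ⟪k, h⟫ * ⟪e, u⟫) * ⟪e, v⟫
        + ⟪e, u⟫ *
          (1 / 2 * (⟪e, h⟫ * ⟪k, v⟫ + ⟪e, k⟫ * ⟪h, v⟫) - 3 / 2 * ⟪k, h⟫ * ⟪e, v⟫)) := by
  have hd : Differentiable ℝ (fderiv ℝ (bergerForm J e ε)) :=
    ((contDiff_bergerForm J e ε).fderiv_right (m := 1) (by simp)).differentiable (by norm_num)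
  have hd' : DifferentiableAt ℝ (fun y => fderiv ℝ (bergerForm J e ε) y h u v) 0 := by fun_prop
  unfold secondDeriv
  rw [← hd'.lineDeriv_eq_fderiv]
  apply HasLineDerivAt.lineDeriv
  have hc : HasDerivAt (fun t : ℝ => conf (0 + t • k)) _ 0 := hasLineDerivAt_conf 0 k
  have hh := hasDerivAt_inner_line h 0 k
  have hu : HasDerivAt (fun t : ℝ => connForm J e (0 + t • k) u) _ 0 :=
    hasLineDerivAt_connForm J e 0 k u
  have hv : HasDerivAt (fun t : ℝ => connForm J e (0 + t • k) v) _ 0 :=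
    hasLineDerivAt_connForm J e 0 k v
  have hu' : HasDerivAt (fun t : ℝ => dConnForm J e (0 + t • k) h u) _ 0 :=
    hasLineDerivAt_dConnForm J e k h u
  have hv' : HasDerivAt (fun t : ℝ => dConnForm J e (0 + t • k) h v) _ 0 :=
    hasLineDerivAt_dConnForm J e k h v
  have h1 := (((hc.fun_pow 3).fun_mul hh).fun_neg.mul_const ⟪u, v⟫).fun_add
    (((hu'.fun_mul hv).fun_add (hu.fun_mul hv')).const_mul (ε - 1))
  unfold HasLineDerivAt
  simp_rw [fderiv_bergerForm_apply]
  refine h1.congr_deriv ?_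
  simp only [zero_smul, add_zero, conf_zero, connForm_zero, dConnForm_zero, inner_zero_left]
  ring

end BergerForm


/-- A positive definite bilinear form on a finite-dimensional space is nondegenerate. -/
lemma isInvertible_of_pos {E : Type*} [NormedAddCommGroup E] [NormedSpace ℝ E]
    [FiniteDimensional ℝ E] (B : E →L[ℝ] E →L[ℝ] ℝ) (hB : ∀ u, u ≠ 0 → 0 < B u u) :
    B.IsInvertible := by
  have hinj : Function.Injective (B : E →ₗ[ℝ] (E →L[ℝ] ℝ)) := by
    rw [← LinearMap.ker_eq_bot, LinearMap.ker_eq_bot']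
    intro u hu
    by_contra hne
    have h1 := hB u hne
    have h2 : B u = 0 := hu
    simp [h2] at h1
  have hrank : Module.finrank ℝ E = Module.finrank ℝ (E →L[ℝ] ℝ) := by
    rw [← (LinearMap.toContinuousLinearMap (𝕜 := ℝ) (E := E) (F' := ℝ)).finrank_eq]
    exact (Subspace.dual_finrank_eq (K := ℝ) (V := E)).symm
  let e := LinearEquiv.ofInjectiveOfFinrankEq (B : E →ₗ[ℝ] (E →L[ℝ] ℝ)) hinj hrank
  refine ⟨e.toContinuousLinearEquiv, ?_⟩
  ext u v
  rfl

/-! ### Jets of a product metric split into those of the factors. -/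

section ProductForm

variable {V W : Type*} [NormedAddCommGroup V] [NormedSpace ℝ V]
  [NormedAddCommGroup W] [NormedSpace ℝ W]

/-- The product of two fields of bilinear forms. -/
def prodForm (G : V → V →L[ℝ] V →L[ℝ] ℝ) (K : W → W →L[ℝ] W →L[ℝ] ℝ) (y : V × W) :
    (V × W) →L[ℝ] (V × W) →L[ℝ] ℝ :=
  pullbackForm (G y.1) (ContinuousLinearMap.fst ℝ V W)
    + pullbackForm (K y.2) (ContinuousLinearMap.snd ℝ V W)

lemma prodForm_apply (G : V → V →L[ℝ] V →L[ℝ] ℝ) (K : W → W →L[ℝ] W →L[ℝ] ℝ)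
    (y u v : V × W) : prodForm G K y u v = G y.1 u.1 v.1 + K y.2 u.2 v.2 := rfl

lemma contDiff_pullbackForm {E F : Type*} [NormedAddCommGroup E] [NormedSpace ℝ E]
    [NormedAddCommGroup F] [NormedSpace ℝ F] {m : ℕ∞ω} {B : E → V →L[ℝ] V →L[ℝ] ℝ}
    (hB : ContDiff ℝ m B) (f : F →L[ℝ] V) :
    ContDiff ℝ m (fun x => pullbackForm (B x) f) := by
  unfold pullbackForm
  exact contDiff_const.clm_comp (hB.clm_comp contDiff_const)

lemma contDiff_prodForm {m : ℕ∞ω} {G : V → V →L[ℝ] V →L[ℝ] ℝ} {K : W → W →L[ℝ] W →L[ℝ] ℝ}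
    (hG : ContDiff ℝ m G) (hK : ContDiff ℝ m K) : ContDiff ℝ m (prodForm G K) :=
  (contDiff_pullbackForm (hG.comp contDiff_fst) _).add
    (contDiff_pullbackForm (hK.comp contDiff_snd) _)

lemma fderiv_comp_fst_apply {f : V → ℝ} {y : V × W} (hf : DifferentiableAt ℝ f y.1) (h : V × W) :
    fderiv ℝ (fun z : V × W => f z.1) y h = fderiv ℝ f y.1 h.1 := by
  have := hf.hasFDerivAt.comp y (hasFDerivAt_fst (𝕜 := ℝ))
  have h1 : HasFDerivAt (fun z : V × W => f z.1) _ y := this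
  rw [h1.fderiv]
  rfl

lemma fderiv_comp_snd_apply {f : W → ℝ} {y : V × W} (hf : DifferentiableAt ℝ f y.2) (h : V × W) :
    fderiv ℝ (fun z : V × W => f z.2) y h = fderiv ℝ f y.2 h.2 := by
  have := hf.hasFDerivAt.comp y (hasFDerivAt_snd (𝕜 := ℝ))
  have h1 : HasFDerivAt (fun z : V × W => f z.2) _ y := this
  rw [h1.fderiv]
  rfl

lemma fderiv_split_apply {f : V → ℝ} {g : W → ℝ} {y : V × W} (hf : DifferentiableAt ℝ f y.1)
    (hg : DifferentiableAt ℝ g y.2) (h : V × W) :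
    fderiv ℝ (fun z : V × W => f z.1 + g z.2) y h = fderiv ℝ f y.1 h.1 + fderiv ℝ g y.2 h.2 := by
  have h1 : DifferentiableAt ℝ (fun z : V × W => f z.1) y := hf.comp y differentiableAt_fst
  have h2 : DifferentiableAt ℝ (fun z : V × W => g z.2) y := hg.comp y differentiableAt_snd
  rw [fderiv_fun_add h1 h2, add_apply, fderiv_comp_fst_apply hf,
    fderiv_comp_snd_apply hg]

lemma fderiv_prodForm_apply {G : V → V →L[ℝ] V →L[ℝ] ℝ} {K : W → W →L[ℝ] W →L[ℝ] ℝ}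
    (hG : ContDiff ℝ 2 G) (hK : ContDiff ℝ 2 K) (y h u v : V × W) :
    fderiv ℝ (prodForm G K) y h u v =
      fderiv ℝ G y.1 h.1 u.1 v.1 + fderiv ℝ K y.2 h.2 u.2 v.2 := by
  have hG' := hG.differentiable (by norm_num) y.1
  have hK' := hK.differentiable (by norm_num) y.2
  rw [fderiv_form_apply ((contDiff_prodForm hG hK).differentiable (by norm_num) y),
    fderiv_form_apply hG', fderiv_form_apply hK']
  simp_rw [prodForm_apply]
  exact fderiv_split_apply (f := fun z => G z u.1 v.1) (g := fun z => K z u.2 v.2)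
    (by fun_prop) (by fun_prop) h

lemma secondDeriv_prodForm {G : V → V →L[ℝ] V →L[ℝ] ℝ} {K : W → W →L[ℝ] W →L[ℝ] ℝ}
    (hG : ContDiff ℝ 2 G) (hK : ContDiff ℝ 2 K) (y k h u v : V × W) :
    secondDeriv (prodForm G K) y k h u v =
      secondDeriv G y.1 k.1 h.1 u.1 v.1 + secondDeriv K y.2 k.2 h.2 u.2 v.2 := by
  have hG' : Differentiable ℝ (fderiv ℝ G) :=
    (hG.fderiv_right (m := 1) (by norm_num)).differentiable (by norm_num)
  have hK' : Differentiable ℝ (fderiv ℝ K) :=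
    (hK.fderiv_right (m := 1) (by norm_num)).differentiable (by norm_num)
  unfold secondDeriv
  simp_rw [fderiv_prodForm_apply hG hK]
  exact fderiv_split_apply (f := fun z => fderiv ℝ G z h.1 u.1 v.1)
    (g := fun z => fderiv ℝ K z h.2 u.2 v.2) (by fun_prop) (by fun_prop) k

lemma christoffelLower_prodForm {G : V → V →L[ℝ] V →L[ℝ] ℝ} {K : W → W →L[ℝ] W →L[ℝ] ℝ}
    (hG : ContDiff ℝ 2 G) (hK : ContDiff ℝ 2 K) (y u v w : V × W) :
    christoffelLower (prodForm G K) y u v w =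
      christoffelLower G y.1 u.1 v.1 w.1 + christoffelLower K y.2 u.2 v.2 w.2 := by
  simp only [christoffelLower_apply, fderiv_prodForm_apply hG hK]
  ring

end ProductForm

/-! ### Curvature of a product of two Berger metrics at the centre of the chart. -/

section BergerCurvature

open scoped RealInnerProductSpace

variable {V : Type*} [NormedAddCommGroup V] [InnerProductSpace ℝ V]

/-- The curvature form `g(R(u, v) v, u)` of a Berger sphere, in terms of the scalar products
`uu`, `uv`, `vv` of the round metric, the vertical components `a`, `b` of `u`, `v`, and
`s = ⟨J u, v⟩`. -/
def bergerNum (ε uu uv vv a b s : ℝ) : ℝ :=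
  ((uu - a ^ 2) * (vv - b ^ 2) - (uv - a * b) ^ 2) - 3 * (ε - 1) * s ^ 2
    + ε ^ 2 * (b ^ 2 * (uu - a ^ 2) - 2 * a * b * (uv - a * b) + a ^ 2 * (vv - b ^ 2))

/-- `J` is a complex structure on the orthogonal complement of the unit vector `e`. -/
structure IsHorizontalComplex (J : V →L[ℝ] V) (e : V) : Prop where
  skew : ∀ u v, ⟪J u, v⟫ = -⟪u, J v⟫
  isometric : ∀ u v, ⟪J u, J v⟫ = ⟪u, v⟫ - ⟪e, u⟫ * ⟪e, v⟫
  unit : ⟪e, e⟫ = 1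

namespace IsHorizontalComplex

variable {J : V →L[ℝ] V} {e : V} (hJ : IsHorizontalComplex J e)
include hJ

lemma map_vertical : J e = 0 := by
  rw [← inner_self_eq_zero (𝕜 := ℝ), hJ.isometric, hJ.unit]
  norm_num

lemma inner_vertical (u : V) : ⟪e, J u⟫ = 0 := by
  have := hJ.skew e u
  rw [hJ.map_vertical, inner_zero_left] at this
  linarith

/-- The terms containing `⟪e, w⟫` cancel because `J` is skew. What remains pairs `w` with horizontal
vectors, so raising the index does not involve the vertical scale. -/
lemma christoffelLower_bergerForm (ε : ℝ) (u v w : V) :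
    christoffelLower (bergerForm J e ε) 0 u v w =
      (ε - 1) * (⟪J u, w⟫ * ⟪e, v⟫ + ⟪J v, w⟫ * ⟪e, u⟫) := by
  simp only [christoffelLower_apply, fderiv_bergerForm_zero]
  have h4 : ⟪J v, u⟫ = -⟪J u, v⟫ := by rw [hJ.skew, real_inner_comm]
  have h5 : ⟪J w, u⟫ = -⟪J u, w⟫ := by rw [hJ.skew, real_inner_comm]
  have h6 : ⟪J w, v⟫ = -⟪J v, w⟫ := by rw [hJ.skew, real_inner_comm]
  rw [h4, h5, h6]
  ring

/-- The Christoffel symbols of the Berger metric at the centre of the chart. -/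
lemma christoffelLower_bergerForm_eq (ε : ℝ) (u v w : V) :
    christoffelLower (bergerForm J e ε) 0 u v w =
      bergerForm J e ε 0 ((ε - 1) • (⟪e, v⟫ • J u + ⟪e, u⟫ • J v)) w := by
  rw [hJ.christoffelLower_bergerForm, bergerForm_zero_apply]
  simp only [inner_smul_left, inner_smul_right, inner_add_left, inner_add_right,
    hJ.inner_vertical, RCLike.conj_to_real]
  ring

/-- The left side is the expression of `form_curvature` with the Christoffel vectors of `(u, v)` and
`(v, v)` inserted explicitly, so that it applies to each factor of a product separately. -/
lemma jet_eq_bergerNum (ε : ℝ) (u v : V) :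
    secondDeriv (bergerForm J e ε) 0 u v v u
        - 1 / 2 * secondDeriv (bergerForm J e ε) 0 u u v v
        - 1 / 2 * secondDeriv (bergerForm J e ε) 0 v v u u
        + christoffelLower (bergerForm J e ε) 0 u v ((ε - 1) • (⟪e, v⟫ • J u + ⟪e, u⟫ • J v))
        - christoffelLower (bergerForm J e ε) 0 u u ((ε - 1) • (⟪e, v⟫ • J v + ⟪e, v⟫ • J v)) =
      bergerNum ε ⟪u, u⟫ ⟪u, v⟫ ⟪v, v⟫ ⟪e, u⟫ ⟪e, v⟫ ⟪J u, v⟫ := by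
  have h4 : ⟪J v, u⟫ = -⟪J u, v⟫ := by rw [hJ.skew, real_inner_comm]
  have h5 : ⟪J u, u⟫ = 0 := by
    have := hJ.skew u u
    have h6 := real_inner_comm (J u) u
    linarith
  have h6 : ⟪J v, v⟫ = 0 := by
    have := hJ.skew v v
    have h6 := real_inner_comm (J v) v
    linarith
  simp only [secondDeriv_bergerForm_zero, hJ.christoffelLower_bergerForm, inner_smul_right,
    inner_add_right, hJ.isometric, h4, h5, h6, real_inner_comm u v, bergerNum]
  ring

/-- Since `J u` is orthogonal to `u` and to `e`, only the part of `v` orthogonal to both contributes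
to `⟪J u, v⟫`. The bound is Cauchy–Schwarz for `J u` and that part, scaled by `A = |J u|²` to avoid
a division; if `A = 0`, then `J u = 0`. -/
lemma sq_inner_map_le (u v : V) :
    ⟪J u, v⟫ ^ 2 ≤ (⟪u, u⟫ - ⟪e, u⟫ ^ 2) * (⟪v, v⟫ - ⟪e, v⟫ ^ 2)
      - (⟪u, v⟫ - ⟪e, u⟫ * ⟪e, v⟫) ^ 2 := by
  set A := ⟪u, u⟫ - ⟪e, u⟫ ^ 2 with hA
  have hJJ : ⟪J u, J u⟫ = A := by rw [hJ.isometric, hA]; ring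
  have hA0 : 0 ≤ A := hJJ ▸ real_inner_self_nonneg
  have h5 : ⟪J u, u⟫ = 0 := by
    have := hJ.skew u u
    have h6 := real_inner_comm (J u) u
    linarith
  have he : ⟪J u, e⟫ = 0 := by rw [real_inner_comm, hJ.inner_vertical]
  set C := ⟪u, v⟫ - ⟪e, u⟫ * ⟪e, v⟫ with hC
  have key := real_inner_mul_inner_self_le (J u)
    (A • (v - ⟪e, v⟫ • e) - C • (u - ⟪e, u⟫ • e))
  have hl : ⟪J u, A • (v - ⟪e, v⟫ • e) - C • (u - ⟪e, u⟫ • e)⟫ = A * ⟪J u, v⟫ := by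
    simp only [inner_sub_right, inner_smul_right, he, h5]
    ring
  have hr : ⟪A • (v - ⟪e, v⟫ • e) - C • (u - ⟪e, u⟫ • e),
      A • (v - ⟪e, v⟫ • e) - C • (u - ⟪e, u⟫ • e)⟫ = A * (A * (⟪v, v⟫ - ⟪e, v⟫ ^ 2) - C ^ 2) := by
    simp only [inner_sub_right, inner_sub_left, inner_smul_right, inner_smul_left, hJ.unit,
      RCLike.conj_to_real, real_inner_comm e u, real_inner_comm e v, real_inner_comm u v]
    rw [hC, hA]
    ring
  rw [hl, hr, hJJ] at key
  rcases hA0.eq_or_lt with h | h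
  · have hz : J u = 0 := by rw [← inner_self_eq_zero (𝕜 := ℝ), hJJ, ← h]
    have hCz : C = 0 := by
      have := hJ.isometric u v
      rw [hz, inner_zero_left] at this
      linarith
    rw [hz, hCz, ← h]
    simp
  · have h2 : 0 < A * A := mul_pos h h
    refine le_of_mul_le_mul_left ?_ h2
    linarith

end IsHorizontalComplex

lemma bergerForm_zero_pos (J : V →L[ℝ] V) {e : V} (he : ⟪e, e⟫ = 1) {ε : ℝ} (hε : 0 < ε)
    {u : V} (hu : u ≠ 0) : 0 < bergerForm J e ε 0 u u := by
  rw [bergerForm_zero_apply]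
  have h1 := real_inner_mul_inner_self_le e u
  rw [he, one_mul] at h1
  have h2 : 0 < ⟪u, u⟫ := real_inner_self_pos.mpr hu
  have h3 : 0 ≤ ⟪e, u⟫ * ⟪e, u⟫ := mul_self_nonneg _
  rcases h3.eq_or_lt with h | h
  · rw [← h]; linarith
  · nlinarith [mul_pos hε h]

variable {W : Type*} [NormedAddCommGroup W] [InnerProductSpace ℝ W]

lemma prodForm_bergerForm_pos {J : V →L[ℝ] V} {e : V} {J' : W →L[ℝ] W} {e' : W}
    (he : ⟪e, e⟫ = 1) (he' : ⟪e', e'⟫ = 1) {ε ε' : ℝ} (hε : 0 < ε) (hε' : 0 < ε')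
    {u : V × W} (hu : u ≠ 0) :
    0 < prodForm (bergerForm J e ε) (bergerForm J' e' ε') 0 u u := by
  rw [prodForm_apply]
  by_cases h1 : u.1 = 0
  · have h2 : u.2 ≠ 0 := fun h => hu (Prod.ext h1 h)
    have := bergerForm_zero_pos J' he' hε' h2
    simpa [h1] using this
  · have h3 := bergerForm_zero_pos J he hε h1
    by_cases h2 : u.2 = 0
    · simpa [h2] using h3
    · exact add_pos h3 (bergerForm_zero_pos J' he' hε' h2)

variable [FiniteDimensional ℝ V] [FiniteDimensional ℝ W]

/-- The curvature of a product of two Berger spheres. -/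
theorem curvature_prodForm_bergerForm {J : V →L[ℝ] V} {e : V} {J' : W →L[ℝ] W} {e' : W}
    (hJ : IsHorizontalComplex J e) (hJ' : IsHorizontalComplex J' e') {ε ε' : ℝ} (hε : 0 < ε)
    (hε' : 0 < ε') (u v : V × W) :
    prodForm (bergerForm J e ε) (bergerForm J' e' ε') 0
        (curvature (prodForm (bergerForm J e ε) (bergerForm J' e' ε')) 0 u v v) u =
      bergerNum ε ⟪u.1, u.1⟫ ⟪u.1, v.1⟫ ⟪v.1, v.1⟫ ⟪e, u.1⟫ ⟪e, v.1⟫ ⟪J u.1, v.1⟫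
        + bergerNum ε' ⟪u.2, u.2⟫ ⟪u.2, v.2⟫ ⟪v.2, v.2⟫ ⟪e', u.2⟫ ⟪e', v.2⟫ ⟪J' u.2, v.2⟫ := by
  have hG : ContDiff ℝ 2 (bergerForm J e ε) := (contDiff_bergerForm J e ε).of_le (by simp)
  have hK : ContDiff ℝ 2 (bergerForm J' e' ε') := (contDiff_bergerForm J' e' ε').of_le (by simp)
  have hinv : (prodForm (bergerForm J e ε) (bergerForm J' e' ε') 0).IsInvertible :=
    isInvertible_of_pos _ fun u hu => prodForm_bergerForm_pos hJ.unit hJ'.unit hε hε' hu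
  -- The two factors do not interact: the Christoffel vector of the product is the pair of those of
  -- the factors.
  have hchr : ∀ a b : V × W,
      christoffel (prodForm (bergerForm J e ε) (bergerForm J' e' ε')) 0 a b =
        ((ε - 1) • (⟪e, b.1⟫ • J a.1 + ⟪e, a.1⟫ • J b.1),
          (ε' - 1) • (⟪e', b.2⟫ • J' a.2 + ⟪e', a.2⟫ • J' b.2)) := by
    intro a b
    refine christoffel_eq hinv fun w => ?_
    rw [christoffelLower_prodForm hG hK, prodForm_apply]
    simp only [Prod.fst_zero, Prod.snd_zero]
    rw [hJ.christoffelLower_bergerForm_eq, hJ'.christoffelLower_bergerForm_eq]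
  rw [form_curvature (contDiff_prodForm hG hK) (fun y u v => by
    simp only [prodForm_apply, bergerForm_symm _ _ _ _ u.1, bergerForm_symm _ _ _ _ u.2]) hinv,
    hchr, hchr]
  simp only [secondDeriv_prodForm hG hK, christoffelLower_prodForm hG hK, Prod.fst_zero,
    Prod.snd_zero]
  rw [← hJ.jet_eq_bergerNum, ← hJ'.jet_eq_bergerNum]
  ring

end BergerCurvature


/-! ### Pinching estimates for one Berger sphere and for the product. -/

section CurvatureBounds

/-- Arithmetic–geometric mean: `(AB' + A'B)² ≥ 4 AB·A'B' ≥ 4 C²C'²`. It makes the mixed term in the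
squared area of a plane in a product nonnegative. -/
lemma two_mul_le_of_sq_le {A B C A' B' C' : ℝ} (hA : 0 ≤ A) (hB : 0 ≤ B) (hA' : 0 ≤ A')
    (hB' : 0 ≤ B') (h : C ^ 2 ≤ A * B) (h' : C' ^ 2 ≤ A' * B') :
    2 * (C * C') ≤ A * B' + A' * B := by
  refine le_trans (le_abs_self _) (abs_le_of_sq_le_sq ?_ (by positivity))
  have h1 : C ^ 2 * C' ^ 2 ≤ (A * B) * (A' * B') :=
    mul_le_mul h h' (sq_nonneg _) (mul_nonneg hA hB)
  nlinarith [sq_nonneg (A * B' - A' * B)]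

lemma horizontal_nonneg {A B C a b : ℝ} (hA : 0 ≤ A) (hB : 0 ≤ B) (h : C ^ 2 ≤ A * B) :
    0 ≤ b ^ 2 * A - 2 * a * b * C + a ^ 2 * B := by
  have := two_mul_le_of_sq_le hA hB (sq_nonneg a) (sq_nonneg b) h
    (by rw [mul_pow] : (a * b) ^ 2 ≤ a ^ 2 * b ^ 2)
  linarith

/-- The area form of a Berger metric. -/
def bergerArea (ε uu uv vv a b : ℝ) : ℝ :=
  (uu + (ε - 1) * a ^ 2) * (vv + (ε - 1) * b ^ 2) - (uv + (ε - 1) * (a * b)) ^ 2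

variable {ε uu uv vv a b s : ℝ}

/-- The coefficients of `P` and `Q` are compared separately. The sign of `ε - 1` decides whether the
horizontal part is largest at `s = 0`, giving `P`, or at `s² = P`, giving `(4 - 3ε)P`. -/
lemma bergerNum_le (hε : 0 < ε) (hu : a ^ 2 ≤ uu) (hv : b ^ 2 ≤ vv)
    (hs : s ^ 2 ≤ (uu - a ^ 2) * (vv - b ^ 2) - (uv - a * b) ^ 2)
    {m : ℝ} (h1 : 1 ≤ m) (h2 : ε ≤ m) (h3 : 4 - 3 * ε ≤ m) :
    bergerNum ε uu uv vv a b s ≤ m * bergerArea ε uu uv vv a b := by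
  set P := (uu - a ^ 2) * (vv - b ^ 2) - (uv - a * b) ^ 2 with hP
  have hP0 : 0 ≤ P := (sq_nonneg s).trans hs
  have hQ := horizontal_nonneg (a := a) (b := b) (sub_nonneg.mpr hu) (sub_nonneg.mpr hv)
    (sub_nonneg.mp hP0)
  set Q := b ^ 2 * (uu - a ^ 2) - 2 * a * b * (uv - a * b) + a ^ 2 * (vv - b ^ 2) with hQd
  have hD : bergerArea ε uu uv vv a b = P + ε * Q := by rw [bergerArea, hP, hQd]; ring
  have hN : bergerNum ε uu uv vv a b s = P - 3 * (ε - 1) * s ^ 2 + ε ^ 2 * Q := rfl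
  have hQ' : ε ^ 2 * Q ≤ m * (ε * Q) := by
    have := mul_le_mul_of_nonneg_right h2 (mul_nonneg hε.le hQ)
    linarith
  have hP' : P - 3 * (ε - 1) * s ^ 2 ≤ m * P := by
    rcases le_total 1 ε with h | h
    · nlinarith [mul_nonneg (sub_nonneg.mpr h) (sq_nonneg s), mul_nonneg (sub_nonneg.mpr h1) hP0]
    · nlinarith [mul_nonneg (sub_nonneg.mpr h) (sub_nonneg.mpr hs),
        mul_nonneg (sub_nonneg.mpr h3) hP0]
  rw [hD, hN]
  linarith

lemma le_bergerNum (hε : 0 < ε) (hu : a ^ 2 ≤ uu) (hv : b ^ 2 ≤ vv)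
    (hs : s ^ 2 ≤ (uu - a ^ 2) * (vv - b ^ 2) - (uv - a * b) ^ 2)
    {k : ℝ} (h1 : k ≤ 1) (h2 : k ≤ ε) (h3 : k ≤ 4 - 3 * ε) :
    k * bergerArea ε uu uv vv a b ≤ bergerNum ε uu uv vv a b s := by
  set P := (uu - a ^ 2) * (vv - b ^ 2) - (uv - a * b) ^ 2 with hP
  have hP0 : 0 ≤ P := (sq_nonneg s).trans hs
  have hQ := horizontal_nonneg (a := a) (b := b) (sub_nonneg.mpr hu) (sub_nonneg.mpr hv)
    (sub_nonneg.mp hP0)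
  set Q := b ^ 2 * (uu - a ^ 2) - 2 * a * b * (uv - a * b) + a ^ 2 * (vv - b ^ 2) with hQd
  have hD : bergerArea ε uu uv vv a b = P + ε * Q := by rw [bergerArea, hP, hQd]; ring
  have hN : bergerNum ε uu uv vv a b s = P - 3 * (ε - 1) * s ^ 2 + ε ^ 2 * Q := rfl
  have hQ' : k * (ε * Q) ≤ ε ^ 2 * Q := by
    have := mul_le_mul_of_nonneg_right h2 (mul_nonneg hε.le hQ)
    linarith
  have hP' : k * P ≤ P - 3 * (ε - 1) * s ^ 2 := by
    rcases le_total 1 ε with h | h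
    · nlinarith [mul_nonneg (sub_nonneg.mpr h) (sub_nonneg.mpr hs),
        mul_nonneg (sub_nonneg.mpr h3) hP0]
    · nlinarith [mul_nonneg (sub_nonneg.mpr h) (sq_nonneg s), mul_nonneg (sub_nonneg.mpr h1) hP0]
  rw [hD, hN]
  linarith

lemma bergerArea_nonneg (hε : 0 < ε) (hu : a ^ 2 ≤ uu) (hv : b ^ 2 ≤ vv)
    (hP0 : 0 ≤ (uu - a ^ 2) * (vv - b ^ 2) - (uv - a * b) ^ 2) :
    0 ≤ bergerArea ε uu uv vv a b := by
  have hQ := horizontal_nonneg (a := a) (b := b) (sub_nonneg.mpr hu) (sub_nonneg.mpr hv)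
    (sub_nonneg.mp hP0)
  have := mul_nonneg hε.le hQ
  unfold bergerArea
  linarith

open scoped RealInnerProductSpace

variable {V W : Type*} [NormedAddCommGroup V] [InnerProductSpace ℝ V]
  [NormedAddCommGroup W] [InnerProductSpace ℝ W]

lemma sq_inner_le_of_unit {e : V} (he : ⟪e, e⟫ = 1) (u : V) : ⟪e, u⟫ ^ 2 ≤ ⟪u, u⟫ := by
  have h1 := real_inner_mul_inner_self_le e u
  rw [he, one_mul] at h1
  rwa [sq]

/-- Positivity is applied to the unnormalised Gram–Schmidt vector `B(u,u) v - B(u,v) u`. -/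
lemma gram_pos {E : Type*} [NormedAddCommGroup E] [NormedSpace ℝ E] (B : E →L[ℝ] E →L[ℝ] ℝ)
    (hsymm : ∀ u v, B u v = B v u) (hB : ∀ u, u ≠ 0 → 0 < B u u) {u v : E}
    (h : LinearIndependent ℝ ![u, v]) : 0 < B u u * B v v - B u v ^ 2 := by
  have hu : u ≠ 0 := by simpa using h.ne_zero 0
  have hBu := hB u hu
  have hw : (B u u) • v - (B u v) • u ≠ 0 := by
    intro h0
    rw [LinearIndependent.pair_iff] at h
    have := (h (-(B u v)) (B u u) (by rw [← h0]; module)).2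
    exact hBu.ne' this
  have h1 := hB _ hw
  have h2 : B ((B u u) • v - (B u v) • u) ((B u u) • v - (B u v) • u) =
      B u u * (B u u * B v v - B u v ^ 2) := by
    simp only [map_sub, map_smul, sub_apply, smul_apply, smul_eq_mul, hsymm v u]
    ring
  rw [h2] at h1
  exact pos_of_mul_pos_right h1 hBu.le

variable [FiniteDimensional ℝ V] [FiniteDimensional ℝ W]

lemma coordSectionalCurvature_prodForm {J : V →L[ℝ] V} {e : V} {J' : W →L[ℝ] W} {e' : W}
    (hJ : IsHorizontalComplex J e) (hJ' : IsHorizontalComplex J' e') {ε ε' : ℝ} (hε : 0 < ε)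
    (hε' : 0 < ε') (u v : V × W) :
    coordSectionalCurvature (prodForm (bergerForm J e ε) (bergerForm J' e' ε')) 0 u v =
      (bergerNum ε ⟪u.1, u.1⟫ ⟪u.1, v.1⟫ ⟪v.1, v.1⟫ ⟪e, u.1⟫ ⟪e, v.1⟫ ⟪J u.1, v.1⟫
        + bergerNum ε' ⟪u.2, u.2⟫ ⟪u.2, v.2⟫ ⟪v.2, v.2⟫ ⟪e', u.2⟫ ⟪e', v.2⟫ ⟪J' u.2, v.2⟫) /
      (prodForm (bergerForm J e ε) (bergerForm J' e' ε') 0 u u *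
        prodForm (bergerForm J e ε) (bergerForm J' e' ε') 0 v v -
        prodForm (bergerForm J e ε) (bergerForm J' e' ε') 0 u v ^ 2) := by
  rw [coordSectionalCurvature, curvature_prodForm_bergerForm hJ hJ' hε hε']

/-- Curvature bounds for a product of two Berger spheres. -/
theorem coordSectionalCurvature_bounds {J : V →L[ℝ] V} {e : V} {J' : W →L[ℝ] W} {e' : W}
    (hJ : IsHorizontalComplex J e) (hJ' : IsHorizontalComplex J' e') {ε ε' : ℝ} (hε : 0 < ε)
    (hε' : 0 < ε') {u v : V × W} (huv : LinearIndependent ℝ ![u, v]) {k m : ℝ}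
    (hk : k ≤ 0) (hkε : k ≤ 4 - 3 * ε) (hkε' : k ≤ 4 - 3 * ε')
    (hm : 1 ≤ m) (hmε : ε ≤ m) (hmε' : ε' ≤ m) (hmε₁ : 4 - 3 * ε ≤ m) (hmε₁' : 4 - 3 * ε' ≤ m) :
    k ≤ coordSectionalCurvature (prodForm (bergerForm J e ε) (bergerForm J' e' ε')) 0 u v ∧
      coordSectionalCurvature (prodForm (bergerForm J e ε) (bergerForm J' e' ε')) 0 u v ≤ m := by
  have hpos := gram_pos (prodForm (bergerForm J e ε) (bergerForm J' e' ε') 0)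
    (fun u v => by
      simp only [prodForm_apply, bergerForm_symm _ _ _ _ u.1, bergerForm_symm _ _ _ _ u.2])
    (fun u hu => prodForm_bergerForm_pos hJ.unit hJ'.unit hε hε' hu) huv
  have hu := sq_inner_le_of_unit hJ.unit u.1
  have hv := sq_inner_le_of_unit hJ.unit v.1
  have hu' := sq_inner_le_of_unit hJ'.unit u.2
  have hv' := sq_inner_le_of_unit hJ'.unit v.2
  have hs := hJ.sq_inner_map_le u.1 v.1
  have hs' := hJ'.sq_inner_map_le u.2 v.2
  have hA := bergerArea_nonneg hε hu hv ((sq_nonneg _).trans hs)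
  have hA' := bergerArea_nonneg hε' hu' hv' ((sq_nonneg _).trans hs')
  -- The Gram determinant of a sum of forms is the sum of the determinants plus `AB' + A'B - 2CC'`,
  -- which is nonnegative.
  have hsum : bergerArea ε ⟪u.1, u.1⟫ ⟪u.1, v.1⟫ ⟪v.1, v.1⟫ ⟪e, u.1⟫ ⟪e, v.1⟫
      + bergerArea ε' ⟪u.2, u.2⟫ ⟪u.2, v.2⟫ ⟪v.2, v.2⟫ ⟪e', u.2⟫ ⟪e', v.2⟫ ≤
      prodForm (bergerForm J e ε) (bergerForm J' e' ε') 0 u u *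
        prodForm (bergerForm J e ε) (bergerForm J' e' ε') 0 v v -
        prodForm (bergerForm J e ε) (bergerForm J' e' ε') 0 u v ^ 2 := by
    simp only [prodForm_apply, Prod.fst_zero, Prod.snd_zero, bergerForm_zero_apply]
    have hdiag : ∀ {δ x y : ℝ}, 0 < δ → y ^ 2 ≤ x → 0 ≤ x + (δ - 1) * y ^ 2 := by
      intro δ x y hδ hxy
      nlinarith [mul_nonneg hδ.le (sq_nonneg y)]
    have := two_mul_le_of_sq_le (hdiag hε hu) (hdiag hε hv) (hdiag hε' hu') (hdiag hε' hv')
      (sub_nonneg.mp hA) (sub_nonneg.mp hA')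
    unfold bergerArea
    linarith
  rw [coordSectionalCurvature_prodForm hJ hJ' hε hε', le_div_iff₀ hpos, div_le_iff₀ hpos]
  constructor
  · have h1 := le_bergerNum hε hu hv hs (hk.trans zero_le_one) (hk.trans hε.le) hkε
    have h2 := le_bergerNum hε' hu' hv' hs' (hk.trans zero_le_one) (hk.trans hε'.le) hkε'
    -- The area of the plane may exceed the sum of the factor areas, so a lower bound passes to the
    -- product only because `k ≤ 0`.
    have h3 := mul_le_mul_of_nonpos_left hsum hk
    linarith
  · have h1 := bergerNum_le hε hu hv hs hm hmε hmε₁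
    have h2 := bergerNum_le hε' hu' hv' hs' hm hmε' hmε₁'
    have h3 := mul_le_mul_of_nonneg_left hsum (zero_le_one.trans hm)
    linarith

end CurvatureBounds


open scoped RealInnerProductSpace

/-! ### Stereographic charts of the sphere and the Hopf structure in them. -/

section SphereChart

variable {n : ℕ}

lemma inner_I_smul_left (u v : Cn n) : ⟪Complex.I • u, v⟫ = -⟪u, Complex.I • v⟫ := by
  simp only [PiLp.inner_apply, PiLp.smul_apply, smul_eq_mul, ← Finset.sum_neg_distrib]
  refine Finset.sum_congr rfl fun i _ => ?_
  simp [Complex.inner]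
  ring

lemma inner_I_smul_I_smul (u v : Cn n) : ⟪Complex.I • u, Complex.I • v⟫ = ⟪u, v⟫ := by
  rw [inner_I_smul_left, smul_smul, Complex.I_mul_I, neg_one_smul, inner_neg_right, neg_neg]

lemma inner_I_smul_self (u : Cn n) : ⟪Complex.I • u, u⟫ = 0 := by
  have h1 := inner_I_smul_left u u
  have h2 := real_inner_comm (Complex.I • u) u
  linarith

lemma hopfForm_apply (z u : Cn n) : hopfForm z u = ⟪Complex.I • z, u⟫ := rfl

/-- The model space of the charts of `S²ⁿ⁺¹`. -/
abbrev Mod (n : ℕ) := EuclideanSpace ℝ (Fin (2 * n + 1))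

lemma inner_self_sph (x : Sph n) : ⟪(x : Cn n), (x : Cn n)⟫ = 1 := by
  rw [real_inner_self_eq_norm_sq, norm_eq_of_mem_sphere x, one_pow]

/-- The isometry of the model space with the tangent space of the sphere at `x`. -/
def tangentIsometry (x : Sph n) : Mod n →ₗᵢ[ℝ] Cn n :=
  (ℝ ∙ ((-x : Sph n) : Cn n))ᗮ.subtypeₗᵢ.comp
    (OrthonormalBasis.fromOrthogonalSpanSingleton (𝕜 := ℝ) (2 * n + 1)
      (ne_zero_of_mem_unit_sphere (-x))).repr.symm.toLinearIsometry

lemma inner_tangentIsometry (x : Sph n) (y : Mod n) : ⟪(x : Cn n), tangentIsometry x y⟫ = 0 := by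
  have h : tangentIsometry x y ∈ (ℝ ∙ ((-x : Sph n) : Cn n))ᗮ :=
    ((OrthonormalBasis.fromOrthogonalSpanSingleton (𝕜 := ℝ) (2 * n + 1)
      (ne_zero_of_mem_unit_sphere (-x))).repr.symm y).2
  rw [Submodule.mem_orthogonal_singleton_iff_inner_right] at h
  simpa using h

lemma exists_tangentIsometry_eq (x : Sph n) {w : Cn n} (hw : ⟪(x : Cn n), w⟫ = 0) :
    ∃ y, tangentIsometry x y = w := by
  have h : w ∈ (ℝ ∙ ((-x : Sph n) : Cn n))ᗮ := by
    rw [Submodule.mem_orthogonal_singleton_iff_inner_right]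
    simpa using hw
  refine ⟨(OrthonormalBasis.fromOrthogonalSpanSingleton (𝕜 := ℝ) (2 * n + 1)
    (ne_zero_of_mem_unit_sphere (-x))).repr ⟨w, h⟩, ?_⟩
  exact congrArg Subtype.val ((OrthonormalBasis.fromOrthogonalSpanSingleton (𝕜 := ℝ) (2 * n + 1)
    (ne_zero_of_mem_unit_sphere (-x))).repr.symm_apply_apply ⟨w, h⟩)

/-- The chart at `x` projects from the antipode `-x`, so `x` itself corresponds to the origin. -/
lemma stereographic'_symm_coe (x : Sph n) (y : Mod n) :
    ((stereographic' (2 * n + 1) (-x)).symm y : Cn n) =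
      conf y • tangentIsometry x y + (2 * conf y - 1) • (x : Cn n) := by
  have h1 : ‖tangentIsometry x y‖ = ‖y‖ := (tangentIsometry x).norm_map y
  have h2 := stereographic'_symm_apply (n := 2 * n + 1) (-x) y
  have h3 : ((stereographic' (2 * n + 1) (-x)).symm y : Cn n) =
      (‖tangentIsometry x y‖ ^ 2 + 4)⁻¹ • (4 : ℝ) • tangentIsometry x y +
        (‖tangentIsometry x y‖ ^ 2 + 4)⁻¹ • (‖tangentIsometry x y‖ ^ 2 - 4) •
          ((-x : Sph n) : Cn n) := h2
  rw [h3, h1]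
  have h4 : ‖y‖ ^ 2 + 4 ≠ 0 := by positivity
  have h5 : ((-x : Sph n) : Cn n) = -(x : Cn n) := rfl
  rw [h5]
  have h6 : conf y = (‖y‖ ^ 2 + 4)⁻¹ * 4 := by rw [conf, add_comm, div_eq_inv_mul]
  have h7 : 2 * conf y - 1 = -((‖y‖ ^ 2 + 4)⁻¹ * (‖y‖ ^ 2 - 4)) := by
    rw [h6]
    field_simp
    ring
  rw [h7, h6]
  module

/-- The vertical unit vector of the model space. -/
def vertical (x : Sph n) : Mod n :=
  (exists_tangentIsometry_eq x (w := Complex.I • (x : Cn n))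
    (by rw [real_inner_comm, inner_I_smul_self])).choose

lemma tangentIsometry_vertical (x : Sph n) :
    tangentIsometry x (vertical x) = Complex.I • (x : Cn n) :=
  (exists_tangentIsometry_eq x (w := Complex.I • (x : Cn n))
    (by rw [real_inner_comm, inner_I_smul_self])).choose_spec

/-- The tangential part of multiplication by `i` on the model space. -/
def complexStr (x : Sph n) : Mod n →L[ℝ] Mod n :=
  (ContinuousLinearMap.adjoint (tangentIsometry x).toContinuousLinearMap).comp
    ((Complex.I • ContinuousLinearMap.id ℝ (Cn n)).comp (tangentIsometry x).toContinuousLinearMap)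

lemma inner_complexStr (x : Sph n) (u v : Mod n) :
    ⟪complexStr x u, v⟫ = ⟪Complex.I • tangentIsometry x u, tangentIsometry x v⟫ := by
  rw [complexStr, ContinuousLinearMap.comp_apply, ContinuousLinearMap.adjoint_inner_left]
  rfl

lemma inner_vertical_eq (x : Sph n) (u : Mod n) :
    ⟪vertical x, u⟫ = ⟪Complex.I • (x : Cn n), tangentIsometry x u⟫ := by
  rw [← (tangentIsometry x).inner_map_map, tangentIsometry_vertical]

/-- Multiplication by `i` takes a tangent vector out of the tangent space by a multiple of `x`; the
second summand removes that normal component. -/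
lemma tangentIsometry_complexStr (x : Sph n) (u : Mod n) :
    tangentIsometry x (complexStr x u) =
      Complex.I • tangentIsometry x u + ⟪vertical x, u⟫ • (x : Cn n) := by
  obtain ⟨w, hw⟩ := exists_tangentIsometry_eq x
    (w := Complex.I • tangentIsometry x u + ⟪vertical x, u⟫ • (x : Cn n)) (by
      rw [inner_add_right, inner_smul_right, inner_self_sph, inner_vertical_eq, inner_I_smul_left]
      ring)
  have h : complexStr x u = w := by
    refine ext_inner_right ℝ fun v => ?_
    rw [inner_complexStr, ← (tangentIsometry x).inner_map_map w, hw, inner_add_left,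
      inner_smul_left, inner_tangentIsometry, mul_zero, add_zero]
  rw [h, hw]

lemma isHorizontalComplex (x : Sph n) : IsHorizontalComplex (complexStr x) (vertical x) where
  skew u v := by
    rw [real_inner_comm (complexStr x v) u, inner_complexStr, inner_complexStr, inner_I_smul_left,
      real_inner_comm]
  isometric u v := by
    have h : ⟪Complex.I • tangentIsometry x u, (x : Cn n)⟫ = -⟪vertical x, u⟫ := by
      rw [inner_I_smul_left, inner_vertical_eq, real_inner_comm]
    rw [inner_complexStr, tangentIsometry_complexStr, inner_add_right, inner_I_smul_I_smul,
      (tangentIsometry x).inner_map_map, inner_smul_right, h]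
    ring
  unit := by
    rw [inner_vertical_eq, tangentIsometry_vertical, inner_I_smul_I_smul, inner_self_sph]

/-- The inverse stereographic projection as a map to the ambient space. -/
def stereoParam (x : Sph n) (y : Mod n) : Cn n :=
  conf y • tangentIsometry x y + (2 * conf y - 1) • (x : Cn n)

lemma contDiff_stereoParam (x : Sph n) : ContDiff ℝ ω (stereoParam x) := by
  have h1 := contDiff_conf (V := Mod n)
  have h2 : ContDiff ℝ ω (tangentIsometry x) :=
    (tangentIsometry x).toContinuousLinearMap.contDiff
  unfold stereoParam
  exact (h1.fun_smul h2).add (((contDiff_const.mul h1).sub contDiff_const).fun_smul contDiff_const)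

lemma fderiv_stereoParam (x : Sph n) (y h : Mod n) :
    fderiv ℝ (stereoParam x) y h =
      conf y • tangentIsometry x h
        - (conf y ^ 2 / 2 * ⟪y, h⟫) • (tangentIsometry x y + (2 : ℝ) • (x : Cn n)) := by
  rw [← ((contDiff_stereoParam x).differentiable (by simp) y).lineDeriv_eq_fderiv]
  apply HasLineDerivAt.lineDeriv
  have hc : HasDerivAt (fun t : ℝ => conf (y + t • h)) _ 0 := hasLineDerivAt_conf y h
  have hL : HasDerivAt (fun t : ℝ => tangentIsometry x (y + t • h)) (tangentIsometry x h) 0 := by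
    simp_rw [map_add, map_smul]
    simpa using ((hasDerivAt_id (0 : ℝ)).smul_const (tangentIsometry x h)).const_add
      (tangentIsometry x y)
  have h1 := (hc.fun_smul hL).fun_add (((hc.const_mul 2).sub_const 1).smul_const (x : Cn n))
  unfold HasLineDerivAt stereoParam
  refine h1.congr_deriv ?_
  simp only [zero_smul, add_zero]
  module

/-- This computation is the source of the formula defining `connForm`. -/
lemma hopfForm_fderiv_stereoParam (x : Sph n) (y u : Mod n) :
    hopfForm (stereoParam x y) (fderiv ℝ (stereoParam x) y u) =
      connForm (complexStr x) (vertical x) y u := by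
  rw [fderiv_stereoParam, connForm_apply, hopfForm_apply, stereoParam, inner_complexStr,
    inner_vertical_eq, inner_vertical_eq]
  have h1 : ⟪Complex.I • tangentIsometry x y, (x : Cn n)⟫ =
      -⟪Complex.I • (x : Cn n), tangentIsometry x y⟫ := by
    rw [inner_I_smul_left, real_inner_comm]
  simp only [smul_add, inner_add_left, inner_sub_right, inner_add_right, inner_smul_right,
    smul_comm Complex.I, inner_smul_left, RCLike.conj_to_real, inner_I_smul_self, h1]
  ring

lemma inner_fderiv_stereoParam (x : Sph n) (y u v : Mod n) :
    ⟪fderiv ℝ (stereoParam x) y u, fderiv ℝ (stereoParam x) y v⟫ = conf y ^ 2 * ⟪u, v⟫ := by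
  have h0 : ∀ w, ⟪tangentIsometry x w, (x : Cn n)⟫ = 0 := fun w => by
    rw [real_inner_comm, inner_tangentIsometry]
  have hc : conf y * (⟪y, y⟫ + 4) = 4 := by
    rw [conf, real_inner_self_eq_norm_sq, add_comm, div_mul_cancel₀]
    positivity
  rw [fderiv_stereoParam, fderiv_stereoParam]
  simp only [inner_add_left, inner_sub_right, inner_add_right, inner_sub_left, inner_smul_right,
    inner_smul_left, RCLike.conj_to_real, inner_tangentIsometry, h0, inner_self_sph,
    (tangentIsometry x).inner_map_map, real_inner_comm y u]
  -- The terms in `⟪y, u⟫ * ⟪y, v⟫` cancel by the relation `conf y * (|y|² + 4) = 4`, leaving a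
  -- conformal metric.
  linear_combination (conf y ^ 3 / 4 * ⟪y, u⟫ * ⟪y, v⟫) * hc

end SphereChart

/-! ### The metric `g(0, c)` in the product chart. -/

section ProductChart

variable {n p : ℕ}

lemma extChartAt_symm_apply (x : SS n p) (y : Mod n × Mod p) :
    (extChartAt (ISS n p) x).symm y =
      ((stereographic' (2 * n + 1) (-x.1)).symm y.1, (stereographic' (2 * p + 1) (-x.2)).symm y.2) :=
  rfl

lemma extChartAt_target_eq_univ (x : SS n p) : (extChartAt (ISS n p) x).target = Set.univ := by
  rw [extChartAt_prod]
  have h1 : (extChartAt (𝓡 (2 * n + 1)) x.1).target = Set.univ := by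
    rw [extChartAt_target]
    have : (chartAt (Mod n) x.1).target = Set.univ := stereographic'_target (-x.1)
    rw [this]
    simp
  have h2 : (extChartAt (𝓡 (2 * p + 1)) x.2).target = Set.univ := by
    rw [extChartAt_target]
    have : (chartAt (Mod p) x.2).target = Set.univ := stereographic'_target (-x.2)
    rw [this]
    simp
  rw [PartialEquiv.prod_target, h1, h2, Set.univ_prod_univ]

lemma extChartAt_self (x : SS n p) : extChartAt (ISS n p) x x = (0 : Mod n × Mod p) := by
  have h : ∀ {m : ℕ} (z : Sph m), stereographic' (2 * m + 1) (-z) z = 0 := by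
    intro m z
    refine Eq.trans (congrArg (OrthonormalBasis.fromOrthogonalSpanSingleton (𝕜 := ℝ) (2 * m + 1)
      (ne_zero_of_mem_unit_sphere (-z))).repr (stereographic_neg_apply z)) (map_zero _)
  exact Prod.ext (h x.1) (h x.2)

/-- The parametrization of `S²ⁿ⁺¹ × S²ᵖ⁺¹` inverse to the chart at `x`. -/
def prodParam (x : SS n p) (y : Mod n × Mod p) : Cn n × Cn p :=
  (stereoParam x.1 y.1, stereoParam x.2 y.2)

lemma incl_extChartAt_symm (x : SS n p) (y : Mod n × Mod p) :
    incl n p ((extChartAt (ISS n p) x).symm y) = prodParam x y := by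
  rw [extChartAt_symm_apply]
  exact Prod.ext (stereographic'_symm_coe x.1 y.1) (stereographic'_symm_coe x.2 y.2)

lemma contDiff_prodParam (x : SS n p) : ContDiff ℝ ω (prodParam x) :=
  ((contDiff_stereoParam x.1).comp contDiff_fst).prodMk
    ((contDiff_stereoParam x.2).comp contDiff_snd)

lemma fderiv_prodParam (x : SS n p) (y h : Mod n × Mod p) :
    fderiv ℝ (prodParam x) y h =
      (fderiv ℝ (stereoParam x.1) y.1 h.1, fderiv ℝ (stereoParam x.2) y.2 h.2) := by
  have h1 := (((contDiff_stereoParam x.1).differentiable (by simp) y.1).hasFDerivAt.comp y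
    (hasFDerivAt_fst (𝕜 := ℝ))).prodMk
    (((contDiff_stereoParam x.2).differentiable (by simp) y.2).hasFDerivAt.comp y
      (hasFDerivAt_snd (𝕜 := ℝ)))
  have h2 : HasFDerivAt (prodParam x) _ y := h1
  rw [h2.fderiv]
  rfl

lemma mdifferentiable_incl : MDifferentiable (ISS n p) 𝓘(ℝ, Cn n × Cn p) (incl n p) := by
  have h1 : ContMDiff (ISS n p) 𝓘(ℝ, Cn n) ω (fun x : SS n p => (x.1 : Cn n)) :=
    contMDiff_coe_sphere.comp contMDiff_fst
  have h2 : ContMDiff (ISS n p) 𝓘(ℝ, Cn p) ω (fun x : SS n p => (x.2 : Cn p)) :=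
    contMDiff_coe_sphere.comp contMDiff_snd
  exact (h1.prodMk_space h2).mdifferentiable (by simp)

lemma mdifferentiable_extChartAt_symm (x : SS n p) :
    MDifferentiable 𝓘(ℝ, Mod n × Mod p) (ISS n p) (extChartAt (ISS n p) x).symm := by
  have h := contMDiffOn_extChartAt_symm (I := ISS n p) (n := ω) x
  rw [extChartAt_target_eq_univ, contMDiffOn_univ] at h
  exact h.mdifferentiable (by simp)

lemma mfderiv_incl_extChartAt_symm (x : SS n p) (y h : Mod n × Mod p) :
    mfderiv (ISS n p) 𝓘(ℝ, Cn n × Cn p) (incl n p) ((extChartAt (ISS n p) x).symm y)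
      (mfderiv 𝓘(ℝ, Mod n × Mod p) (ISS n p) (extChartAt (ISS n p) x).symm y h) =
      fderiv ℝ (prodParam x) y h := by
  have h1 := mfderiv_comp y (mdifferentiable_incl (n := n) (p := p) _)
    (mdifferentiable_extChartAt_symm x y)
  have h2 : incl n p ∘ (extChartAt (ISS n p) x).symm = prodParam x :=
    funext (incl_extChartAt_symm x)
  rw [h2, mfderiv_eq_fderiv] at h1
  rw [h1]
  rfl

/-- With `a = 0` the product `η₁η₂` drops out, and each factor is the round metric plus `(ε - 1)
η²`, with `ε = 1/c` and `ε = c` respectively. The identity holds on the whole chart, so it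
determines the curvature. -/
lemma chartMetric_eq (x : SS n p) {c : ℝ} (hc : c ≠ 0) :
    chartMetric (ISS n p) (metric n p 0 c) x =
      prodForm (bergerForm (complexStr x.1) (vertical x.1) (1 / c))
        (bergerForm (complexStr x.2) (vertical x.2) c) := by
  funext y
  refine ContinuousLinearMap.ext fun u => ContinuousLinearMap.ext fun v => ?_
  have h1 : chartMetric (ISS n p) (metric n p 0 c) x y u v =
      ambientMetric 0 c (prodParam x y) (fderiv ℝ (prodParam x) y u)
        (fderiv ℝ (prodParam x) y v) := by
    rw [← incl_extChartAt_symm, ← mfderiv_incl_extChartAt_symm, ← mfderiv_incl_extChartAt_symm]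
    rfl
  rw [h1, ambientMetric_apply, prodForm_apply, fderiv_prodParam, fderiv_prodParam,
    bergerForm_apply, bergerForm_apply]
  simp only [prodParam, inner_fderiv_stereoParam, hopfForm_fderiv_stereoParam]
  field_simp
  ring

/-- At the centre the derivative of the parametrization is the linear isometry itself, so scalar
products of chart components can be computed with ambient vectors. -/
lemma fderiv_prodParam_mfderiv_extChartAt (x : SS n p) (u : TangentSpace (ISS n p) x) :
    ((tangentIsometry x.1 (mfderiv (ISS n p) 𝓘(ℝ, Mod n × Mod p) (extChartAt (ISS n p) x) x u).1,
      tangentIsometry x.2 (mfderiv (ISS n p) 𝓘(ℝ, Mod n × Mod p) (extChartAt (ISS n p) x) x u).2) :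
        Cn n × Cn p) =
      mfderiv (ISS n p) 𝓘(ℝ, Cn n × Cn p) (incl n p) x u := by
  have h0 : MDifferentiableAt 𝓘(ℝ, Mod n × Mod p) 𝓘(ℝ, Cn n × Cn p) (prodParam x)
      (extChartAt (ISS n p) x x) :=
    ((contDiff_prodParam x).differentiable (by simp) _).mdifferentiableAt
  have h1 := mfderiv_comp x h0 (mdifferentiableAt_extChartAt (I := ISS n p) (mem_chart_source _ x))
  have h2 : prodParam x ∘ extChartAt (ISS n p) x =ᶠ[nhds x] incl n p := by
    filter_upwards [extChartAt_source_mem_nhds (I := ISS n p) x] with z hz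
    rw [Function.comp_apply, ← incl_extChartAt_symm, PartialEquiv.left_inv _ hz]
  rw [h2.mfderiv_eq, mfderiv_eq_fderiv] at h1
  rw [h1]
  have h3 := fderiv_prodParam x (extChartAt (ISS n p) x x)
    (mfderiv (ISS n p) 𝓘(ℝ, Mod n × Mod p) (extChartAt (ISS n p) x) x u)
  refine Eq.trans ?_ h3.symm
  simp only [fderiv_stereoParam, extChartAt_self, Prod.fst_zero, Prod.snd_zero, conf_zero,
    inner_zero_left, mul_zero, zero_smul, sub_zero, one_smul]

lemma linearIndependent_mfderiv_extChartAt (x : SS n p) {u v : TangentSpace (ISS n p) x}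
    (h : LinearIndependent ℝ ![u, v]) :
    LinearIndependent ℝ ![mfderiv (ISS n p) 𝓘(ℝ, Mod n × Mod p) (extChartAt (ISS n p) x) x u,
      mfderiv (ISS n p) 𝓘(ℝ, Mod n × Mod p) (extChartAt (ISS n p) x) x v] := by
  have hinv := isInvertible_mfderiv_extChartAt (I := ISS n p) (mem_extChartAt_source x)
  rw [LinearIndependent.pair_iff] at h ⊢
  intro s t hst
  refine h s t (hinv.injective ?_)
  rw [map_add, map_smul, map_smul, map_zero]
  exact hst

end ProductChart


open scoped RealInnerProductSpace

/-! ### Ambient velocities of one-parameter orbits. -/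

section Orbit

variable {n p : ℕ}

/-- The value at `v` of a matrix, as a linear function of the matrix. -/
def mulVecAt (v : Cn n) : Matrix (Fin (n + 1)) (Fin (n + 1)) ℂ →ₗ[ℝ] Cn n where
  toFun A := WithLp.toLp 2 (A *ᵥ v.ofLp)
  map_add' A B := by rw [Matrix.add_mulVec, WithLp.toLp_add]
  map_smul' t A := by rw [Matrix.smul_mulVec, WithLp.toLp_smul, RingHom.id_apply]

lemma mulVecAt_apply (v : Cn n) (A : Matrix (Fin (n + 1)) (Fin (n + 1)) ℂ) :
    mulVecAt v A = WithLp.toLp 2 (A *ᵥ v.ofLp) := rfl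

section

attribute [local instance] Matrix.linftyOpNormedRing Matrix.linftyOpNormedAlgebra

/-- The operator norm is auxiliary: it makes the matrices a Banach algebra, and composition with
`mulVecAt` returns to the norm of `Cn n`. -/
lemma contDiff_exp_mulVec (A : Matrix (Fin (n + 1)) (Fin (n + 1)) ℂ) (v : Cn n) :
    ContDiff ℝ ω (fun t : ℝ => mulVecAt v (NormedSpace.exp (t • A))) := by
  have h1 : ContDiff ℝ ω (fun t : ℝ => NormedSpace.exp (t • A)) := by
    rw [contDiff_iff_contDiffAt]
    intro t
    exact (NormedSpace.exp_analytic (𝕂 := ℝ) (t • A)).contDiffAt.comp t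
      (contDiff_id.smul contDiff_const).contDiffAt
  exact (LinearMap.toContinuousLinearMap (mulVecAt v)).contDiff.comp h1

lemma hasDerivAt_exp_mulVec (A : Matrix (Fin (n + 1)) (Fin (n + 1)) ℂ) (v : Cn n) :
    HasDerivAt (fun t : ℝ => mulVecAt v (NormedSpace.exp (t • A))) (mulVecAt v A) 0 := by
  have h1 := hasDerivAt_exp_smul_const (𝕂 := ℝ) A 0
  rw [zero_smul, NormedSpace.exp_zero, one_mul] at h1
  exact (LinearMap.toContinuousLinearMap (mulVecAt v)).hasFDerivAt.comp_hasDerivAt 0 h1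

end

lemma act_expU_coe (ξ : LieU n) (z : Sph n) (t : ℝ) :
    (act (expU (t • ξ)) z : Cn n) =
      mulVecAt z (NormedSpace.exp (t • (ξ : Matrix (Fin (n + 1)) (Fin (n + 1)) ℂ))) := rfl

lemma contMDiff_act_expU (ξ : LieU n) (z : Sph n) :
    ContMDiff 𝓘(ℝ, ℝ) (𝓡 (2 * n + 1)) ω (fun t : ℝ => act (expU (t • ξ)) z) := by
  have h : ContMDiff 𝓘(ℝ, ℝ) 𝓘(ℝ, Cn n) ω (fun t : ℝ => (act (expU (t • ξ)) z : Cn n)) :=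
    (contDiff_exp_mulVec (ξ : Matrix (Fin (n + 1)) (Fin (n + 1)) ℂ) z).contMDiff
  exact h.codRestrict_sphere (n := 2 * n + 1) fun t => (act (expU (t • ξ)) z).2

/-- The ambient velocity of the orbit of the base point. -/
def orbitVec (ζ : LieU n × LieU p) : Cn n × Cn p :=
  (mulVecAt (e0 n : Cn n) (ζ.1 : Matrix (Fin (n + 1)) (Fin (n + 1)) ℂ),
    mulVecAt (e0 p : Cn p) (ζ.2 : Matrix (Fin (p + 1)) (Fin (p + 1)) ℂ))

lemma act_expU_zero_smul (ξ : LieU n) (z : Sph n) : act (expU ((0 : ℝ) • ξ)) z = z := by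
  apply Subtype.ext
  rw [act_expU_coe, zero_smul, NormedSpace.exp_zero, mulVecAt_apply, Matrix.one_mulVec]

lemma mfderiv_incl_tangentVec (ζ : LieU n × LieU p) :
    mfderiv (ISS n p) 𝓘(ℝ, Cn n × Cn p) (incl n p) (basePt n p) (tangentVec ζ) = orbitVec ζ := by
  set γ : ℝ → SS n p :=
    fun t => (act (expU (t • ζ.1)) (e0 n), act (expU (t • ζ.2)) (e0 p)) with hγ
  have hγ0 : γ 0 = basePt n p :=
    Prod.ext (act_expU_zero_smul ζ.1 (e0 n)) (act_expU_zero_smul ζ.2 (e0 p))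
  have hd : MDifferentiableAt 𝓘(ℝ, ℝ) (ISS n p) γ 0 :=
    ((contMDiff_act_expU ζ.1 (e0 n)).prodMk (contMDiff_act_expU ζ.2 (e0 p))).mdifferentiableAt
      (by simp)
  have h1 := mfderiv_comp (0 : ℝ) (mdifferentiable_incl (n := n) (p := p) (γ 0)) hd
  rw [hγ0] at h1
  have h2 : HasDerivAt (incl n p ∘ γ) (orbitVec ζ) 0 :=
    (hasDerivAt_exp_mulVec (ζ.1 : Matrix (Fin (n + 1)) (Fin (n + 1)) ℂ) (e0 n)).prodMk
      (hasDerivAt_exp_mulVec (ζ.2 : Matrix (Fin (p + 1)) (Fin (p + 1)) ℂ) (e0 p))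
  rw [mfderiv_eq_fderiv] at h1
  have h3 : fderiv ℝ (incl n p ∘ γ) 0 (1 : ℝ) = orbitVec ζ := h2.deriv
  rw [← h3, h1]
  rfl

end Orbit

/-! ### Curvature of explicit planes at the base point. -/

section Planes

variable {n p : ℕ}

lemma coordSectionalCurvature_chart (x : SS n p) {c : ℝ} (hc : 0 < c) (a b : Mod n × Mod p)
    {U V : Cn n × Cn p} (hU : (tangentIsometry x.1 a.1, tangentIsometry x.2 a.2) = U)
    (hV : (tangentIsometry x.1 b.1, tangentIsometry x.2 b.2) = V) :
    coordSectionalCurvature (prodForm (bergerForm (complexStr x.1) (vertical x.1) (1 / c))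
        (bergerForm (complexStr x.2) (vertical x.2) c)) 0 a b =
      (bergerNum (1 / c) ⟪U.1, U.1⟫ ⟪U.1, V.1⟫ ⟪V.1, V.1⟫ ⟪Complex.I • (x.1 : Cn n), U.1⟫
          ⟪Complex.I • (x.1 : Cn n), V.1⟫ ⟪Complex.I • U.1, V.1⟫
        + bergerNum c ⟪U.2, U.2⟫ ⟪U.2, V.2⟫ ⟪V.2, V.2⟫ ⟪Complex.I • (x.2 : Cn p), U.2⟫
          ⟪Complex.I • (x.2 : Cn p), V.2⟫ ⟪Complex.I • U.2, V.2⟫) /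
      (ambientMetric 0 c (incl n p x) U U * ambientMetric 0 c (incl n p x) V V
        - ambientMetric 0 c (incl n p x) U V ^ 2) := by
  have hmet : ∀ a b : Mod n × Mod p,
      ambientMetric 0 c (incl n p x) (tangentIsometry x.1 a.1, tangentIsometry x.2 a.2)
        (tangentIsometry x.1 b.1, tangentIsometry x.2 b.2) =
      prodForm (bergerForm (complexStr x.1) (vertical x.1) (1 / c))
        (bergerForm (complexStr x.2) (vertical x.2) c) 0 a b := by
    intro a b
    simp only [prodForm_apply, bergerForm_zero_apply, ambientMetric_apply, Prod.fst_zero,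
      Prod.snd_zero, hopfForm_apply, incl, inner_vertical_eq,
      (tangentIsometry x.1).inner_map_map, (tangentIsometry x.2).inner_map_map]
    field_simp
    ring
  subst hU hV
  rw [coordSectionalCurvature_prodForm (isHorizontalComplex x.1) (isHorizontalComplex x.2)
    (one_div_pos.mpr hc) hc]
  simp only [hmet, inner_complexStr, inner_vertical_eq,
    (tangentIsometry x.1).inner_map_map, (tangentIsometry x.2).inner_map_map]

/-- The curvature of a plane in terms of ambient vectors. -/
theorem sectionalCurvature_eq (x : SS n p) {c : ℝ} (hc : 0 < c) (u v : TangentSpace (ISS n p) x)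
    {U V : Cn n × Cn p} (hU : mfderiv (ISS n p) 𝓘(ℝ, Cn n × Cn p) (incl n p) x u = U)
    (hV : mfderiv (ISS n p) 𝓘(ℝ, Cn n × Cn p) (incl n p) x v = V) :
    sectionalCurvature (ISS n p) (metric n p 0 c) x u v =
      (bergerNum (1 / c) ⟪U.1, U.1⟫ ⟪U.1, V.1⟫ ⟪V.1, V.1⟫ ⟪Complex.I • (x.1 : Cn n), U.1⟫
          ⟪Complex.I • (x.1 : Cn n), V.1⟫ ⟪Complex.I • U.1, V.1⟫
        + bergerNum c ⟪U.2, U.2⟫ ⟪U.2, V.2⟫ ⟪V.2, V.2⟫ ⟪Complex.I • (x.2 : Cn p), U.2⟫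
          ⟪Complex.I • (x.2 : Cn p), V.2⟫ ⟪Complex.I • U.2, V.2⟫) /
      (ambientMetric 0 c (incl n p x) U U * ambientMetric 0 c (incl n p x) V V
        - ambientMetric 0 c (incl n p x) U V ^ 2) := by
  rw [sectionalCurvature, chartMetric_eq x hc.ne', extChartAt_self]
  rw [← fderiv_prodParam_mfderiv_extChartAt] at hU hV
  exact coordSectionalCurvature_chart x hc _ _ hU hV

/-- The sectional curvatures of `g(0, c)` are bounded as those of a product of Berger spheres. -/
theorem sectionalCurvature_bounds (x : SS n p) {c : ℝ} (hc : 0 < c)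
    {u v : TangentSpace (ISS n p) x} (huv : LinearIndependent ℝ ![u, v]) {k m : ℝ}
    (hk : k ≤ 0) (hkε : k ≤ 4 - 3 * (1 / c)) (hkε' : k ≤ 4 - 3 * c)
    (hm : 1 ≤ m) (hmε : 1 / c ≤ m) (hmε' : c ≤ m) (hmε₁ : 4 - 3 * (1 / c) ≤ m)
    (hmε₁' : 4 - 3 * c ≤ m) :
    k ≤ sectionalCurvature (ISS n p) (metric n p 0 c) x u v ∧
      sectionalCurvature (ISS n p) (metric n p 0 c) x u v ≤ m := by
  rw [sectionalCurvature, chartMetric_eq x hc.ne', extChartAt_self]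
  exact coordSectionalCurvature_bounds (isHorizontalComplex x.1) (isHorizontalComplex x.2)
    (one_div_pos.mpr hc) hc (linearIndependent_mfderiv_extChartAt x huv) hk hkε hkε' hm hmε hmε'
    hmε₁ hmε₁'

/-- Cramer's rule: pairing a linear relation with both vectors gives a linear system whose
determinant is the Gram determinant. -/
lemma linearIndependent_of_gram {E F : Type*} [AddCommGroup E] [Module ℝ E]
    [NormedAddCommGroup F] [NormedSpace ℝ F] (f : E →ₗ[ℝ] F) (B : F →L[ℝ] F →L[ℝ] ℝ)
    (hsymm : ∀ u v, B u v = B v u) {u v : E}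
    (h : 0 < B (f u) (f u) * B (f v) (f v) - B (f u) (f v) ^ 2) : LinearIndependent ℝ ![u, v] := by
  rw [LinearIndependent.pair_iff]
  intro s t hst
  have h0 : s • f u + t • f v = 0 := by rw [← map_smul, ← map_smul, ← map_add, hst, map_zero]
  have h1 : s * B (f u) (f u) + t * B (f u) (f v) = 0 := by
    have := congrArg (B (f u)) h0
    simpa using this
  have h2 : s * B (f u) (f v) + t * B (f v) (f v) = 0 := by
    have := congrArg (B (f v)) h0
    simpa [hsymm (f v) (f u)] using this
  constructor
  · refine (mul_eq_zero.mp ?_).resolve_right h.ne'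
    linear_combination B (f v) (f v) * h1 - B (f u) (f v) * h2
  · refine (mul_eq_zero.mp ?_).resolve_right h.ne'
    linear_combination B (f u) (f u) * h2 - B (f u) (f v) * h1

lemma ambientMetric_symm (a c : ℝ) (x u v : Cn n × Cn p) :
    ambientMetric a c x u v = ambientMetric a c x v u := by
  rw [ambientMetric_apply, ambientMetric_apply, real_inner_comm u.1, real_inner_comm u.2]
  ring

/-- The squared area `D` serves twice: its positivity gives linear independence, and it is the
denominator of the curvature. -/
lemma curvatureOfPlaneEq_of_orbitVec {c : ℝ} (hc : 0 < c) {ζ ζ' : LieU n × LieU p}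
    {U V : Cn n × Cn p} (hU : orbitVec ζ = U) (hV : orbitVec ζ' = V) {κ D : ℝ} (hD : 0 < D)
    (hDeq : ambientMetric 0 c (incl n p (basePt n p)) U U *
      ambientMetric 0 c (incl n p (basePt n p)) V V
        - ambientMetric 0 c (incl n p (basePt n p)) U V ^ 2 = D)
    (hN : bergerNum (1 / c) ⟪U.1, U.1⟫ ⟪U.1, V.1⟫ ⟪V.1, V.1⟫ ⟪Complex.I • (e0 n : Cn n), U.1⟫
          ⟪Complex.I • (e0 n : Cn n), V.1⟫ ⟪Complex.I • U.1, V.1⟫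
        + bergerNum c ⟪U.2, U.2⟫ ⟪U.2, V.2⟫ ⟪V.2, V.2⟫ ⟪Complex.I • (e0 p : Cn p), U.2⟫
          ⟪Complex.I • (e0 p : Cn p), V.2⟫ ⟪Complex.I • U.2, V.2⟫ = κ * D) :
    CurvatureOfPlaneEq (ISS n p) (metric n p 0 c) (basePt n p) (tangentVec ζ) (tangentVec ζ') κ := by
  subst hU hV
  constructor
  · refine linearIndependent_of_gram
      (mfderiv (ISS n p) 𝓘(ℝ, Cn n × Cn p) (incl n p) (basePt n p)).toLinearMap
      (ambientMetric 0 c (incl n p (basePt n p))) (ambientMetric_symm 0 c _) ?_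
    have h1 := mfderiv_incl_tangentVec ζ
    have h2 := mfderiv_incl_tangentVec ζ'
    rw [← h1, ← h2] at hDeq
    rw [← hDeq] at hD
    exact hD
  · rw [sectionalCurvature_eq (basePt n p) hc _ _ (mfderiv_incl_tangentVec ζ)
      (mfderiv_incl_tangentVec ζ'), hDeq, div_eq_iff hD.ne']
    exact hN

/-- The standard basis vector `e_ν` of `ℂⁿ⁺¹`. -/
abbrev stdVec (n : ℕ) (ν : Fin (n + 1)) : Cn n := EuclideanSpace.single ν 1

lemma e0_coe : (e0 n : Cn n) = stdVec n 0 := rfl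

/-- Since `T 0 0` is twice a matrix unit, the factor `1/2` in `X` makes its velocity the unit Hopf
vector. -/
lemma mulVecAt_X : mulVecAt (e0 n : Cn n) (X n : Matrix (Fin (n + 1)) (Fin (n + 1)) ℂ) =
    Complex.I • stdVec n 0 := by
  ext i
  rcases eq_or_ne i 0 with rfl | h
  · simp [mulVecAt, X, T, e0]
    ring
  · simp [mulVecAt, X, T, e0, h.symm, h]

lemma mulVecAt_Yodd (ν : Fin n) :
    mulVecAt (e0 n : Cn n) (Yodd ν : Matrix (Fin (n + 1)) (Fin (n + 1)) ℂ) =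
    stdVec n ν.succ := by
  ext i
  simp [mulVecAt, Yodd, Z, e0, Matrix.single_apply, eq_comm]

lemma mulVecAt_Yeven (ν : Fin n) :
    mulVecAt (e0 n : Cn n) (Yeven ν : Matrix (Fin (n + 1)) (Fin (n + 1)) ℂ) =
    Complex.I • stdVec n ν.succ := by
  ext i
  simp [mulVecAt, Yeven, T, e0, Matrix.single_apply, eq_comm]

lemma inner_stdVec_self (i : Fin (n + 1)) : ⟪stdVec n i, stdVec n i⟫ = 1 := by
  rw [real_inner_self_eq_norm_sq, PiLp.norm_single]
  simp

lemma inner_stdVec_of_ne {i j : Fin (n + 1)} (h : i ≠ j) : ⟪stdVec n i, stdVec n j⟫ = 0 := by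
  rw [PiLp.inner_apply]
  refine Finset.sum_eq_zero fun k _ => ?_
  rcases eq_or_ne k i with rfl | hk
  · simp [h]
  · simp [hk]

lemma inner_I_smul_stdVec (i j : Fin (n + 1)) : ⟪Complex.I • stdVec n i, stdVec n j⟫ = 0 := by
  rcases eq_or_ne i j with rfl | h
  · exact inner_I_smul_self _
  · rw [PiLp.inner_apply]
    refine Finset.sum_eq_zero fun k _ => ?_
    rcases eq_or_ne k i with rfl | hk
    · simp [h]
    · simp [hk]

lemma inner_stdVec_I_smul (i j : Fin (n + 1)) : ⟪stdVec n i, Complex.I • stdVec n j⟫ = 0 := by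
  rw [real_inner_comm, inner_I_smul_stdVec]

lemma orbitVec_left (ξ : LieU n) : orbitVec ((ξ, 0) : LieU n × LieU p) =
    (mulVecAt (e0 n : Cn n) (ξ : Matrix (Fin (n + 1)) (Fin (n + 1)) ℂ), 0) :=
  Prod.ext rfl (map_zero (mulVecAt (e0 p : Cn p)))

lemma orbitVec_right (ξ : LieU p) : orbitVec ((0, ξ) : LieU n × LieU p) =
    (0, mulVecAt (e0 p : Cn p) (ξ : Matrix (Fin (p + 1)) (Fin (p + 1)) ℂ)) :=
  Prod.ext (map_zero (mulVecAt (e0 n : Cn n))) rfl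

variable {c : ℝ}

lemma curvature_Yodd_Yeven_left (hc : 0 < c) (l : Fin n) :
    CurvatureOfPlaneEq (ISS n p) (metric n p 0 c) (basePt n p) (tangentVec (Yodd l, 0))
      (tangentVec (Yeven l, 0)) (4 - 3 * (1 / c)) := by
  refine curvatureOfPlaneEq_of_orbitVec (D := 1) hc ((orbitVec_left _).trans (by
    rw [mulVecAt_Yodd])) ((orbitVec_left _).trans (by rw [mulVecAt_Yeven])) one_pos ?_ ?_
  · simp only [ambientMetric_apply, hopfForm_apply, incl, basePt, e0_coe, inner_I_smul_I_smul,
      inner_I_smul_stdVec, inner_stdVec_I_smul, inner_stdVec_self, inner_zero_right,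
      inner_stdVec_of_ne (Fin.succ_ne_zero l).symm]
    ring
  · simp only [bergerNum, e0_coe, inner_I_smul_I_smul, smul_zero, inner_zero_right,
      inner_I_smul_stdVec, inner_stdVec_I_smul, inner_stdVec_self,
      inner_stdVec_of_ne (Fin.succ_ne_zero l).symm]
    ring

lemma curvature_Yodd_Yeven_right (hc : 0 < c) (m : Fin p) :
    CurvatureOfPlaneEq (ISS n p) (metric n p 0 c) (basePt n p) (tangentVec (0, Yodd m))
      (tangentVec (0, Yeven m)) (4 - 3 * c) := by
  refine curvatureOfPlaneEq_of_orbitVec (D := 1) hc ((orbitVec_right _).trans (by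
    rw [mulVecAt_Yodd])) ((orbitVec_right _).trans (by rw [mulVecAt_Yeven])) one_pos ?_ ?_
  · simp only [ambientMetric_apply, hopfForm_apply, incl, basePt, e0_coe, inner_I_smul_I_smul,
      inner_I_smul_stdVec, inner_stdVec_I_smul, inner_stdVec_self, inner_zero_right,
      inner_stdVec_of_ne (Fin.succ_ne_zero m).symm]
    ring
  · simp only [bergerNum, e0_coe, inner_I_smul_I_smul, smul_zero, inner_zero_right,
      inner_I_smul_stdVec, inner_stdVec_I_smul, inner_stdVec_self,
      inner_stdVec_of_ne (Fin.succ_ne_zero m).symm]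
    ring

lemma mulVecAt_smul_X (t : ℝ) :
    mulVecAt (e0 n : Cn n) ((t • X n : LieU n) : Matrix (Fin (n + 1)) (Fin (n + 1)) ℂ) =
      t • Complex.I • stdVec n 0 := by
  rw [← mulVecAt_X]
  exact (mulVecAt (e0 n : Cn n)).map_smul t _

/-- The factor `√c` makes `X` a unit vector, since `g(X, X) = 1/c`. The plane contains the vertical
direction, so `P = s = 0` and `Q = c`, and the numerator is `c / c² = 1 / c`. -/
lemma curvature_X_left (hc : 0 < c) {ξ : LieU n} {l : Fin n}
    (hξ : mulVecAt (e0 n : Cn n) (ξ : Matrix (Fin (n + 1)) (Fin (n + 1)) ℂ) = stdVec n l.succ ∨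
      mulVecAt (e0 n : Cn n) (ξ : Matrix (Fin (n + 1)) (Fin (n + 1)) ℂ) =
        Complex.I • stdVec n l.succ) :
    CurvatureOfPlaneEq (ISS n p) (metric n p 0 c) (basePt n p) (tangentVec (√c • X n, 0))
      (tangentVec (ξ, 0)) (1 / c) := by
  have hs : √c * √c = c := Real.mul_self_sqrt hc.le
  have h1 : 1 / c * (√c * √c) = 1 := by rw [hs, one_div, inv_mul_cancel₀ hc.ne']
  have h3 : ⟪Complex.I • Complex.I • stdVec n 0, stdVec n l.succ⟫ = 0 := by
    rw [inner_I_smul_left, inner_I_smul_I_smul, inner_stdVec_of_ne (Fin.succ_ne_zero l).symm,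
      neg_zero]
  refine curvatureOfPlaneEq_of_orbitVec (D := 1) hc ((orbitVec_left _).trans (by
    rw [mulVecAt_smul_X])) (orbitVec_left _) one_pos ?_ ?_
  · rcases hξ with h | h <;> rw [h] <;>
    simp only [ambientMetric_apply, hopfForm_apply, incl, basePt, e0_coe, inner_I_smul_I_smul,
      inner_I_smul_stdVec, inner_stdVec_self, inner_zero_right,
      inner_smul_right, inner_smul_left, RCLike.conj_to_real,
      inner_stdVec_of_ne (Fin.succ_ne_zero l).symm] <;>
    linear_combination h1
  · have h2 : (1 / c) ^ 2 * (√c * √c) = 1 / c := by linear_combination (1 / c) * h1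
    rcases hξ with h | h <;> rw [h] <;>
    simp only [bergerNum, e0_coe, inner_I_smul_I_smul, smul_zero, h3,
      smul_comm Complex.I, inner_I_smul_stdVec, inner_stdVec_self,
      inner_zero_right, inner_smul_right, inner_smul_left, RCLike.conj_to_real,
      inner_stdVec_of_ne (Fin.succ_ne_zero l).symm] <;>
    linear_combination h2

/-- Planes spanned by one vector in each factor are flat. -/
lemma curvature_mixed (hc : 0 < c) {ξ : LieU n} {η : LieU p} {U : Cn n} {V : Cn p}
    (hξ : mulVecAt (e0 n : Cn n) (ξ : Matrix (Fin (n + 1)) (Fin (n + 1)) ℂ) = U)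
    (hη : mulVecAt (e0 p : Cn p) (η : Matrix (Fin (p + 1)) (Fin (p + 1)) ℂ) = V)
    (hU : 0 < ⟪U, U⟫ + (1 / c - 1) * hopfForm (stdVec n 0) U ^ 2)
    (hV : 0 < ⟪V, V⟫ + (c - 1) * hopfForm (stdVec p 0) V ^ 2) :
    CurvatureOfPlaneEq (ISS n p) (metric n p 0 c) (basePt n p) (tangentVec (ξ, 0))
      (tangentVec (0, η)) 0 := by
  refine curvatureOfPlaneEq_of_orbitVec hc ((orbitVec_left _).trans (by rw [hξ]))
    ((orbitVec_right _).trans (by rw [hη])) (mul_pos hU hV) ?_ ?_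
  · simp only [ambientMetric_apply, incl, basePt, e0_coe, inner_zero_left, inner_zero_right,
      map_zero]
    field_simp
    ring
  -- In each factor one of the two vectors is zero, so both numerators vanish.
  · simp [bergerNum]

end Planes

end Hopf
end

/-! ### Comparison of the candidate extremes in the three ranges. -/

theorem proposition5 (n p : ℕ) (hnp : n ≤ p) (c : ℝ) (hc : c = √((n : ℝ) / (p : ℝ))) :
    -- 1. the range `0 < n/p ≤ 1/9`
    ((0 < (n : ℝ) / p ∧ (n : ℝ) / p ≤ 1 / 9) →
      (∀ (x : Hopf.SS n p) (u v : TangentSpace (Hopf.ISS n p) x), LinearIndependent ℝ ![u, v] →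
        4 - 3 * √((p : ℝ) / n) ≤
            Hopf.sectionalCurvature (Hopf.ISS n p) (Hopf.metric n p 0 c) x u v ∧
          Hopf.sectionalCurvature (Hopf.ISS n p) (Hopf.metric n p 0 c) x u v ≤
            √((p : ℝ) / n)) ∧
      (∀ l : Fin n,
        Hopf.CurvatureOfPlaneEq (Hopf.ISS n p) (Hopf.metric n p 0 c) (Hopf.basePt n p)
          (Hopf.tangentVec (Hopf.Yodd l, 0)) (Hopf.tangentVec (Hopf.Yeven l, 0))
          (4 - 3 * √((p : ℝ) / n))) ∧
      (∀ l : Fin n,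
        Hopf.CurvatureOfPlaneEq (Hopf.ISS n p) (Hopf.metric n p 0 c) (Hopf.basePt n p)
            (Hopf.tangentVec (√c • Hopf.X n, 0)) (Hopf.tangentVec (Hopf.Yodd l, 0))
            √((p : ℝ) / n) ∧
          Hopf.CurvatureOfPlaneEq (Hopf.ISS n p) (Hopf.metric n p 0 c) (Hopf.basePt n p)
            (Hopf.tangentVec (√c • Hopf.X n, 0)) (Hopf.tangentVec (Hopf.Yeven l, 0))
            √((p : ℝ) / n))) ∧
    -- 2. the range `1/9 < n/p ≤ 9/16`
    ((1 / 9 < (n : ℝ) / p ∧ (n : ℝ) / p ≤ 9 / 16) →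
      (∀ (x : Hopf.SS n p) (u v : TangentSpace (Hopf.ISS n p) x), LinearIndependent ℝ ![u, v] →
        4 - 3 * √((p : ℝ) / n) ≤
            Hopf.sectionalCurvature (Hopf.ISS n p) (Hopf.metric n p 0 c) x u v ∧
          Hopf.sectionalCurvature (Hopf.ISS n p) (Hopf.metric n p 0 c) x u v ≤
            4 - 3 * √((n : ℝ) / p)) ∧
      (∀ l : Fin n,
        Hopf.CurvatureOfPlaneEq (Hopf.ISS n p) (Hopf.metric n p 0 c) (Hopf.basePt n p)
          (Hopf.tangentVec (Hopf.Yodd l, 0)) (Hopf.tangentVec (Hopf.Yeven l, 0))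
          (4 - 3 * √((p : ℝ) / n))) ∧
      (∀ m : Fin p,
        Hopf.CurvatureOfPlaneEq (Hopf.ISS n p) (Hopf.metric n p 0 c) (Hopf.basePt n p)
          (Hopf.tangentVec (0, Hopf.Yodd m)) (Hopf.tangentVec (0, Hopf.Yeven m))
          (4 - 3 * √((n : ℝ) / p)))) ∧
    -- 3. the range `9/16 < n/p ≤ 1`
    ((9 / 16 < (n : ℝ) / p ∧ (n : ℝ) / p ≤ 1) →
      (∀ (x : Hopf.SS n p) (u v : TangentSpace (Hopf.ISS n p) x), LinearIndependent ℝ ![u, v] →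
        0 ≤ Hopf.sectionalCurvature (Hopf.ISS n p) (Hopf.metric n p 0 c) x u v ∧
          Hopf.sectionalCurvature (Hopf.ISS n p) (Hopf.metric n p 0 c) x u v ≤
            4 - 3 * √((n : ℝ) / p)) ∧
      Hopf.CurvatureOfPlaneEq (Hopf.ISS n p) (Hopf.metric n p 0 c) (Hopf.basePt n p)
        (Hopf.tangentVec (Hopf.X n, 0)) (Hopf.tangentVec (0, Hopf.X p)) 0 ∧
      (∀ (l : Fin n) (m : Fin p),
        Hopf.CurvatureOfPlaneEq (Hopf.ISS n p) (Hopf.metric n p 0 c) (Hopf.basePt n p)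
            (Hopf.tangentVec (Hopf.Yodd l, 0)) (Hopf.tangentVec (0, Hopf.Yodd m)) 0 ∧
          Hopf.CurvatureOfPlaneEq (Hopf.ISS n p) (Hopf.metric n p 0 c) (Hopf.basePt n p)
            (Hopf.tangentVec (Hopf.Yeven l, 0)) (Hopf.tangentVec (0, Hopf.Yeven m)) 0) ∧
      (∀ m : Fin p,
        Hopf.CurvatureOfPlaneEq (Hopf.ISS n p) (Hopf.metric n p 0 c) (Hopf.basePt n p)
          (Hopf.tangentVec (0, Hopf.Yodd m)) (Hopf.tangentVec (0, Hopf.Yeven m))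
          (4 - 3 * √((n : ℝ) / p)))) := by
  -- Division by zero gives zero, so positivity of the quotient excludes both `n = 0` and `p = 0`.
  have key : 0 < (n : ℝ) / p → 0 < c ∧ c * (1 / c) = 1 ∧ √((p : ℝ) / n) = 1 / c := by
    intro h
    have hc0 : 0 < c := hc ▸ Real.sqrt_pos.mpr h
    refine ⟨hc0, mul_one_div_cancel hc0.ne', ?_⟩
    rw [hc, one_div, ← Real.sqrt_inv, inv_div]
  have hsq : 0 < (n : ℝ) / p → c ^ 2 = (n : ℝ) / p := fun h => by rw [hc, Real.sq_sqrt h.le]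
  rw [← hc]
  refine ⟨fun ⟨h0, h1⟩ => ?_, fun ⟨h0, h1⟩ => ?_, fun ⟨h0, h1⟩ => ?_⟩
  · obtain ⟨hc0, hcc, hs⟩ := key h0
    have hc2 := hsq h0
    rw [hs]
    set s := 1 / c with hsd
    have hc3 : c ≤ 1 / 3 := by nlinarith
    have hs3 : 3 ≤ s := by rw [hsd, le_div_iff₀ hc0]; linarith
    -- After multiplication by `c` this reads `(1 - c)(1 - 3c) ≥ 0`, hence the threshold `c = 1/3`.
    have hmid : 4 - 3 * c ≤ s := by
      rw [hsd, le_div_iff₀ hc0]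
      nlinarith
    refine ⟨fun x u v huv => ?_, Hopf.curvature_Yodd_Yeven_left hc0, fun l =>
      ⟨Hopf.curvature_X_left hc0 (Or.inl (Hopf.mulVecAt_Yodd l)),
        Hopf.curvature_X_left hc0 (Or.inr (Hopf.mulVecAt_Yeven l))⟩⟩
    apply Hopf.sectionalCurvature_bounds x hc0 huv <;> try rw [← hsd]
    all_goals linarith
  · have hpos : 0 < (n : ℝ) / p := by linarith
    obtain ⟨hc0, hcc, hs⟩ := key hpos
    have hc2 := hsq hpos
    rw [hs]
    set s := 1 / c with hsd
    have hc3 : c ≤ 3 / 4 := by nlinarith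
    have hc4 : 1 / 3 < c := by nlinarith
    -- This makes the lower bound `4 - 3s` nonpositive, as the product estimate requires.
    have hs3 : 4 / 3 ≤ s := by rw [hsd, le_div_iff₀ hc0]; linarith
    have hs4 : s ≤ 3 := by rw [hsd, div_le_iff₀ hc0]; linarith
    -- Here `1/3 < c ≤ 1`, so `(1 - c)(3c - 1) ≥ 0` and the comparison is reversed.
    have hmid : s ≤ 4 - 3 * c := by
      rw [hsd, div_le_iff₀ hc0]
      nlinarith
    refine ⟨fun x u v huv => ?_, Hopf.curvature_Yodd_Yeven_left hc0,
      Hopf.curvature_Yodd_Yeven_right hc0⟩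
    apply Hopf.sectionalCurvature_bounds x hc0 huv <;> try rw [← hsd]
    all_goals linarith
  · have hpos : 0 < (n : ℝ) / p := by linarith
    obtain ⟨hc0, hcc, hs⟩ := key hpos
    have hc2 := hsq hpos
    set s := 1 / c with hsd
    have hc3 : 3 / 4 < c := by nlinarith
    have hc4 : c ≤ 1 := by nlinarith
    have hs3 : 1 ≤ s := by rw [hsd, le_div_iff₀ hc0]; linarith
    -- Now `4 - 3s ≥ 0`, so the flat mixed planes give the minimum.
    have hs4 : s ≤ 4 / 3 := by rw [hsd, div_le_iff₀ hc0]; linarith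
    have hmid : s ≤ 4 - 3 * c := by
      rw [hsd, div_le_iff₀ hc0]
      nlinarith
    -- Positive lengths, needed for the mixed planes to be nondegenerate; the vertical vector has
    -- squared length `t`, while the horizontal ones have length `1` for every `t`.
    have hX : ∀ (m : ℕ) (t : ℝ), 0 < t →
        0 < inner ℝ (Complex.I • Hopf.stdVec m 0) (Complex.I • Hopf.stdVec m 0) +
          (t - 1) * Hopf.hopfForm (Hopf.stdVec m 0) (Complex.I • Hopf.stdVec m 0) ^ 2 := by
      intro m t ht
      rw [Hopf.hopfForm_apply, Hopf.inner_I_smul_I_smul, Hopf.inner_stdVec_self]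
      linarith
    have hYodd : ∀ (m : ℕ) (t : ℝ) (l : Fin m),
        0 < inner ℝ (Hopf.stdVec m l.succ) (Hopf.stdVec m l.succ) +
          (t - 1) * Hopf.hopfForm (Hopf.stdVec m 0) (Hopf.stdVec m l.succ) ^ 2 := by
      intro m t l
      rw [Hopf.hopfForm_apply, Hopf.inner_stdVec_self, Hopf.inner_I_smul_stdVec]
      norm_num
    have hYeven : ∀ (m : ℕ) (t : ℝ) (l : Fin m),
        0 < inner ℝ (Complex.I • Hopf.stdVec m l.succ) (Complex.I • Hopf.stdVec m l.succ) +
          (t - 1) * Hopf.hopfForm (Hopf.stdVec m 0) (Complex.I • Hopf.stdVec m l.succ) ^ 2 := by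
      intro m t l
      rw [Hopf.hopfForm_apply, Hopf.inner_I_smul_I_smul, Hopf.inner_I_smul_I_smul,
        Hopf.inner_stdVec_self, Hopf.inner_stdVec_of_ne (Fin.succ_ne_zero l).symm]
      norm_num
    refine ⟨fun x u v huv => ?_,
      Hopf.curvature_mixed hc0 Hopf.mulVecAt_X Hopf.mulVecAt_X
        (hX n _ (one_div_pos.mpr hc0)) (hX p c hc0),
      fun l m => ⟨Hopf.curvature_mixed hc0 (Hopf.mulVecAt_Yodd l) (Hopf.mulVecAt_Yodd m)
          (hYodd n _ l) (hYodd p c m),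
        Hopf.curvature_mixed hc0 (Hopf.mulVecAt_Yeven l) (Hopf.mulVecAt_Yeven m)
          (hYeven n _ l) (hYeven p c m)⟩,
      Hopf.curvature_Yodd_Yeven_right hc0⟩
    apply Hopf.sectionalCurvature_bounds x hc0 huv <;> try rw [← hsd]
    all_goals linarith
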